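/- All $C^*$-algebras are complex. A grading of a $C^*$-algebra $A$ is a $*$-automorphism $\gamma$ with $\gamma^2=\mathrm{id}$; it is inner if $\gamma(a)=\Gamma a\Gamma^*$ for some self-adjoint unitary $\Gamma$ in the multiplier algebra of $A$. Let $(B,\beta)$ be a unital graded $C^*$-algebra. Write $\mathfrak S(B,\beta)=\{x\in B: x=x^*=x^{-1},\ \beta(x)=-x\}$, and let $\beta_n$ be the entrywise extension of $\beta$ to $M_n(B)$. If $e\in\mathfrak S(B,\beta)$ is homotopic to $-e$ in $\mathfrak S(B,\beta)$, let $$D\!K_e(B,\beta)=\Big(\bigsqcup_{n}\mathfrak S(M_n(B),\beta_n)\Big)\Big/\sim_h^e ,$$ where $x\sim_h^e y$ if $x\oplus e\oplus\cdots\oplus e$ and $y\oplus e\oplus\cdots\oplus e$ are homotopic in $\mathfrak S(M_N(B),\beta_N)$ for some $N$; this is an abelian group under $[x]+[y]=[x\oplus y]$. For a unital graded $C^*$-algebra $(A,\gamma)$ let $\gamma_{ev}=\gamma\otimes\mathrm{Ad}_{\sigma_z}$ on $M_2(A)=A\otimes M_2(\mathbb C)$ and put $$D\!K(A,\gamma)=D\!K_{1\otimes\sigma_x}(M_2(A),\gamma_{ev}),\qquad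 K_1(A,\mathrm{id})=D\!K_{1\otimes\sigma_x}(A\otimes\mathbb C l_2,\mathrm{id}\otimes\mathrm{st}),$$ where $\mathbb C l_2$ is the complex Clifford algebra with odd generators $\sigma_x,\sigma_y$, that is, $(\mathbb C l_2,\mathrm{st})=(M_2(\mathbb C),\mathrm{Ad}_{\sigma_z})$. Let $KU_1(A)=\bigsqcup_n U(M_n(A))/\sim_h^1$ be the group of stable homotopy classes of unitaries (stabilised by $u\mapsto u\oplus 1$, with addition induced by $\oplus$). For a $C^*$-algebra $A$ which need not be unital, let $A^+$ be the $C^*$-algebra obtained by adding a unit and $\gamma^+$ the extension of $\gamma$ to $A^+$; then each of $D\!K(A,\gamma)$, $K_1(A,\mathrm{id})$, $KU_1(A)$ is defined as the kernel of the homomorphism $D\!K(A^+,\gamma^+)\to D\!K(\mathbb C,\mathrm{id})$, $K_1(A^+,\mathrm{id})\to K_1(\mathbb C,\mathrm{id})$, $KU_1(A^+)\to KU_1(\mathbb C)$, respectively, induced by the canonical map $A^+\to\mathbb C$. **Proposition.** Let $(A,\gamma)$ be an inner graded complex $C^*$-algebra. Then there are group isomorphisms $$D\!K(A,\gamma)\;\cong\;K_1(A,\mathrm{id})\;\cong\;KU_1(A).$$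 This holds for unital $A$ with the direct definitions of the three groups, and for every $A$, unital or not, with the definitions through $A^+$. -/

import Mathlib

open scoped Matrix

noncomputable section

namespace VanDaele

/-! ## Gradings -/

/-- A grading on a complex star algebra: a star automorphism `γ` with `γ ∘ γ = id`. -/
structure Grading (A : Type*) [Add A] [Mul A] [SMul ℂ A] [Star A] where
  /-- the automorphism -/
  aut : A ≃⋆ₐ[ℂ] A
  invol : ∀ a, aut (aut a) = a

/-- A grading of a C⋆-algebra is inner if it is `Ad_Γ` for a self-adjoint unitary `Γ` of the
multiplier algebra (here `𝓜(ℂ, A)`, and `A` is embedded in it in the canonical way). -/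
def Grading.IsInner {A : Type*} [NonUnitalCStarAlgebra A] (γ : Grading A) : Prop :=
  ∃ Γ : DoubleCentralizer ℂ A, star Γ = Γ ∧ Γ * Γ = 1 ∧
    ∀ a : A, DoubleCentralizer.coe ℂ (γ.aut a) = Γ * DoubleCentralizer.coe ℂ a * star Γ

/-- The trivial grading `id`. -/
def Grading.trivial (A : Type*) [Add A] [Mul A] [SMul ℂ A] [Star A] : Grading A where
  aut := StarAlgEquiv.refl ℂ A
  invol _ := rfl

/-- The odd self-adjoint unitaries `𝔖(B, γ)` of a graded unital algebra. -/
def oddSAU {B : Type*} [Ring B] [StarRing B] [Algebra ℂ B] (γ : Grading B) : Set B :=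
  {x | star x = x ∧ x * x = 1 ∧ γ.aut x = -x}

section Matrices

/-- The Pauli matrix `σ_x` with entries in `B`, that is `1 ⊗ σ_x` in `M₂(B) = B ⊗ M₂(ℂ)`. -/
def sigmaX (B : Type*) [Ring B] : Matrix (Fin 2) (Fin 2) B := !![0, 1; 1, 0]

/-- The Pauli matrix `σ_z` with entries in `B`, that is `1 ⊗ σ_z` in `M₂(B) = B ⊗ M₂(ℂ)`. -/
def sigmaZ (B : Type*) [Ring B] : Matrix (Fin 2) (Fin 2) B := !![1, 0; 0, -1]

lemma sigmaZ_mul_self {B : Type*} [Ring B] : sigmaZ B * sigmaZ B = 1 := by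
  ext i j; fin_cases i <;> fin_cases j <;> simp [sigmaZ, Matrix.mul_apply]

lemma star_sigmaZ {B : Type*} [Ring B] [StarRing B] : star (sigmaZ B) = sigmaZ B := by
  ext i j; fin_cases i <;> fin_cases j <;> simp [sigmaZ, Matrix.star_apply]

variable {B : Type*} [Ring B] [StarRing B] [Algebra ℂ B]

/-- The standard extension of a grading to matrices, applying it to each entry. -/
def Grading.matrix (γ : Grading B) (n : Type) [Fintype n] : Grading (Matrix n n B) where
  aut :=
    { toFun := fun x => x.map γ.aut
      invFun := fun x => x.map γ.aut
      left_inv := fun x => by ext i j; exact γ.invol _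
      right_inv := fun x => by ext i j; exact γ.invol _
      map_mul' := fun x y => by ext i j; simp [Matrix.mul_apply, map_sum, map_mul]
      map_add' := fun x y => by ext i j; simp
      map_star' := fun x => by ext i j; simp [Matrix.star_apply, map_star]
      map_smul' := fun r x => by ext i j; simp }
  invol x := by ext i j; exact γ.invol _

lemma matrix_sigmaZ (γ : Grading B) : (γ.matrix (Fin 2)).aut (sigmaZ B) = sigmaZ B := by
  ext i j
  change γ.aut (sigmaZ B i j) = _
  have h1 : γ.aut 1 = 1 := map_one γ.aut
  fin_cases i <;> fin_cases j <;> simp [sigmaZ, h1]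

/-- The grading `γ_ev = γ ⊗ Ad_{σ_z}` on `M₂(B) = B ⊗ M₂(ℂ)`: apply `γ` to each entry, then
conjugate with `σ_z`. -/
def Grading.ev (γ : Grading B) : Grading (Matrix (Fin 2) (Fin 2) B) where
  aut :=
    { toFun := fun x => sigmaZ B * (γ.matrix (Fin 2)).aut x * sigmaZ B
      invFun := fun x => sigmaZ B * (γ.matrix (Fin 2)).aut x * sigmaZ B
      left_inv := fun x => by
        simp only [map_mul, matrix_sigmaZ, Grading.invol]
        rw [← mul_assoc, ← mul_assoc, sigmaZ_mul_self, one_mul, mul_assoc, sigmaZ_mul_self, mul_one]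
      right_inv := fun x => by
        simp only [map_mul, matrix_sigmaZ, Grading.invol]
        rw [← mul_assoc, ← mul_assoc, sigmaZ_mul_self, one_mul, mul_assoc, sigmaZ_mul_self, mul_one]
      map_mul' := fun x y => by
        have h : ∀ a b : Matrix (Fin 2) (Fin 2) B, sigmaZ B * (a * b) * sigmaZ B =
            sigmaZ B * a * (sigmaZ B * sigmaZ B) * b * sigmaZ B := fun a b => by
          rw [sigmaZ_mul_self, mul_one]; simp only [mul_assoc]
        rw [map_mul, h]; simp only [mul_assoc]
      map_add' := fun x y => by rw [map_add, mul_add, add_mul]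
      map_star' := fun x => by rw [map_star, star_mul, star_mul, star_sigmaZ, mul_assoc]
      map_smul' := fun r x => by rw [map_smul, mul_smul_comm, smul_mul_assoc] }
  invol x := by
    change sigmaZ B * (γ.matrix (Fin 2)).aut (sigmaZ B * (γ.matrix (Fin 2)).aut x * sigmaZ B)
      * sigmaZ B = x
    simp only [map_mul, matrix_sigmaZ, Grading.invol]
    rw [← mul_assoc, ← mul_assoc, sigmaZ_mul_self, one_mul, mul_assoc, sigmaZ_mul_self, mul_one]

end Matrices

/-! ## Stable homotopy classes

`M_n(B)` carries the topology of entrywise convergence. For a C⋆-algebra `B` this is the topology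
of the C⋆-norm of `M_n(B)`. -/

lemma matrix_topology_eq {n : ℕ} {A : Type*} [CStarAlgebra A] [PartialOrder A] [StarOrderedRing A] :
    (inferInstance : TopologicalSpace (Matrix (Fin n) (Fin n) A)) =
      (CStarMatrix.instNormedAddCommGroup (m := Fin n) (n := Fin n)
        (A := A)).toMetricSpace.toPseudoMetricSpace.toUniformSpace.toTopologicalSpace := rfl

section Stable

variable {B : Type*} [Ring B]

/-- The block sum `x ⊕ y = diag(x, y)`. -/
def blockSum {n m : ℕ} (x : Matrix (Fin n) (Fin n) B) (y : Matrix (Fin m) (Fin m) B) :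
    Matrix (Fin (n + m)) (Fin (n + m)) B :=
  Matrix.reindex finSumFinEquiv finSumFinEquiv (Matrix.fromBlocks x 0 0 y)

/-- For `n ≤ N`, the matrix `x ⊕ e ⊕ ⋯ ⊕ e` of size `N`. -/
def pad (e : B) {n : ℕ} (N : ℕ) (x : Matrix (Fin n) (Fin n) B) : Matrix (Fin N) (Fin N) B :=
  fun i j => if h : (i : ℕ) < n ∧ (j : ℕ) < n then x ⟨i, h.1⟩ ⟨j, h.2⟩
    else if i = j then e else 0

/-- Sets of matrices of all sizes over `B`, closed under block sums and under conjugation by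
unitary scalar matrices, together with a base point in `B` all of whose multiples
`e ⊕ ⋯ ⊕ e` belong to them. -/
structure MatrixFamily (B : Type*) [Ring B] [StarRing B] [Algebra ℂ B] where
  /-- the admissible matrices of size `n` -/
  carrier : ∀ n : ℕ, Set (Matrix (Fin n) (Fin n) B)
  /-- the base point -/
  base : B
  diagonal_mem : ∀ n, Matrix.diagonal (fun _ : Fin n => base) ∈ carrier n
  blockSum_mem : ∀ {n m : ℕ} {x : Matrix (Fin n) (Fin n) B} {y : Matrix (Fin m) (Fin m) B},
    x ∈ carrier n → y ∈ carrier m → blockSum x y ∈ carrier (n + m)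
  conj_mem : ∀ {n : ℕ} {x : Matrix (Fin n) (Fin n) B} (w : Matrix (Fin n) (Fin n) ℂ),
    star w * w = 1 → w * star w = 1 → x ∈ carrier n →
    (algebraMap ℂ B).mapMatrix w * x * (algebraMap ℂ B).mapMatrix (star w) ∈ carrier n

lemma pad_self (e : B) {n : ℕ} (x : Matrix (Fin n) (Fin n) B) : pad e n x = x := by
  ext i j; simp [pad]

lemma pad_pad (e : B) {n N M : ℕ} (h : n ≤ N) (x : Matrix (Fin n) (Fin n) B) :
    pad e M (pad e N x) = pad e M x := by
  ext i j
  simp only [pad, Fin.ext_iff]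
  split_ifs <;> first | rfl | omega

lemma pad_add (e : B) {n k : ℕ} (x : Matrix (Fin n) (Fin n) B) :
    pad e (n + k) x = blockSum x (Matrix.diagonal fun _ : Fin k => e) := by
  ext i j
  obtain ⟨i, rfl⟩ := finSumFinEquiv.surjective i
  obtain ⟨j, rfl⟩ := finSumFinEquiv.surjective j
  rcases i with i | i <;> rcases j with j | j
  · simp [pad, blockSum]
  · simp [pad, blockSum, Fin.ext_iff]; omega
  · simp [pad, blockSum, Fin.ext_iff]; omega
  · simp [pad, blockSum, Fin.ext_iff, Matrix.diagonal_apply]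

lemma continuous_pad [TopologicalSpace B] (e : B) {n : ℕ} (N : ℕ) :
    Continuous (pad e N : Matrix (Fin n) (Fin n) B → Matrix (Fin N) (Fin N) B) := by
  refine continuous_matrix fun i j => ?_
  unfold pad
  split_ifs
  · exact continuous_id.matrix_elem _ _
  · exact continuous_const
  · exact continuous_const

lemma continuous_blockSum_left [TopologicalSpace B] {n m : ℕ} (y : Matrix (Fin m) (Fin m) B) :
    Continuous (fun x : Matrix (Fin n) (Fin n) B => blockSum x y) :=
  (continuous_id.matrix_fromBlocks continuous_const continuous_const continuous_const).matrix_reindex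
    _ _

lemma continuous_blockSum_right [TopologicalSpace B] {n m : ℕ} (x : Matrix (Fin n) (Fin n) B) :
    Continuous (fun y : Matrix (Fin m) (Fin m) B => blockSum x y) :=
  (continuous_const.matrix_fromBlocks continuous_const continuous_const continuous_id).matrix_reindex
    _ _

lemma blockSum_mul {n m : ℕ} (x x' : Matrix (Fin n) (Fin n) B) (y y' : Matrix (Fin m) (Fin m) B) :
    blockSum x y * blockSum x' y' = blockSum (x * x') (y * y') := by
  simp [blockSum, Matrix.submatrix_mul_equiv, Matrix.fromBlocks_multiply]

lemma blockSum_one {n m : ℕ} :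
    blockSum (1 : Matrix (Fin n) (Fin n) B) (1 : Matrix (Fin m) (Fin m) B) = 1 := by
  simp [blockSum, Matrix.fromBlocks_one]

lemma star_blockSum [StarRing B] {n m : ℕ} (x : Matrix (Fin n) (Fin n) B)
    (y : Matrix (Fin m) (Fin m) B) : star (blockSum x y) = blockSum (star x) (star y) := by
  simp [blockSum, Matrix.star_eq_conjTranspose, Matrix.conjTranspose_submatrix,
    Matrix.fromBlocks_conjTranspose]

lemma blockSum_map {C : Type*} [Ring C] {n m : ℕ} (x : Matrix (Fin n) (Fin n) B)
    (y : Matrix (Fin m) (Fin m) B) (f : B → C) (hf : f 0 = 0) :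
    (blockSum x y).map f = blockSum (x.map f) (y.map f) := by
  ext i j
  obtain ⟨i, rfl⟩ := finSumFinEquiv.surjective i
  obtain ⟨j, rfl⟩ := finSumFinEquiv.surjective j
  rcases i with i | i <;> rcases j with j | j <;> simp [blockSum, hf]

lemma blockSum_neg {n m : ℕ} (x : Matrix (Fin n) (Fin n) B)
    (y : Matrix (Fin m) (Fin m) B) : blockSum (-x) (-y) = -blockSum x y := by
  ext i j
  obtain ⟨i, rfl⟩ := finSumFinEquiv.surjective i
  obtain ⟨j, rfl⟩ := finSumFinEquiv.surjective j
  rcases i with i | i <;> rcases j with j | j <;> simp [blockSum]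

namespace MatrixFamily

variable [StarRing B] [Algebra ℂ B] (F : MatrixFamily B)

lemma pad_mem {n N : ℕ} (h : n ≤ N) {x : Matrix (Fin n) (Fin n) B} (hx : x ∈ F.carrier n) :
    pad F.base N x ∈ F.carrier N := by
  obtain ⟨k, rfl⟩ := Nat.exists_eq_add_of_le h
  rw [pad_add]
  exact F.blockSum_mem hx (F.diagonal_mem k)

section Top

variable [TopologicalSpace B]

lemma joined_pad {n N : ℕ} (h : n ≤ N) {x y : Matrix (Fin n) (Fin n) B}
    (hxy : JoinedIn (F.carrier n) x y) :
    JoinedIn (F.carrier N) (pad F.base N x) (pad F.base N y) :=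
  (hxy.map (continuous_pad F.base N)).mono (by rintro _ ⟨z, hz, rfl⟩; exact F.pad_mem h hz)

/-- Stable homotopy: `x ∼ y` if `x ⊕ e ⊕ ⋯ ⊕ e` and `y ⊕ e ⊕ ⋯ ⊕ e` are joined by a continuous path
of admissible matrices of some size `N`. -/
def Rel (x y : Σ n, F.carrier n) : Prop :=
  ∃ N, x.1 ≤ N ∧ y.1 ≤ N ∧
    JoinedIn (F.carrier N) (pad F.base N x.2.1) (pad F.base N y.2.1)

lemma rel_equivalence : Equivalence F.Rel where
  refl x := ⟨x.1, le_rfl, le_rfl, JoinedIn.refl (F.pad_mem le_rfl x.2.2)⟩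
  symm := fun ⟨N, h1, h2, h⟩ => ⟨N, h2, h1, h.symm⟩
  trans := fun {x y z} ⟨N, h1, h2, h⟩ ⟨M, h3, h4, h'⟩ => by
    refine ⟨max N M, h1.trans (le_max_left _ _), h4.trans (le_max_right _ _), ?_⟩
    have a := F.joined_pad (le_max_left N M) h
    have b := F.joined_pad (le_max_right N M) h'
    rw [pad_pad _ h1, pad_pad _ h2] at a
    rw [pad_pad _ h3, pad_pad _ h4] at b
    exact a.trans b

/-- The setoid of stable homotopy. -/
def setoid : Setoid (Σ n, F.carrier n) := ⟨F.Rel, F.rel_equivalence⟩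

lemma rel_of_joined {n : ℕ} {x y : Matrix (Fin n) (Fin n) B} (h : JoinedIn (F.carrier n) x y) :
    F.Rel ⟨n, x, h.source_mem⟩ ⟨n, y, h.target_mem⟩ :=
  ⟨n, le_rfl, le_rfl, F.joined_pad le_rfl h⟩

lemma rel_pad {n N : ℕ} (h : n ≤ N) {x : Matrix (Fin n) (Fin n) B} (hx : x ∈ F.carrier n) :
    F.Rel ⟨n, x, hx⟩ ⟨N, pad F.base N x, F.pad_mem h hx⟩ := by
  refine ⟨N, h, le_rfl, ?_⟩
  simp only [pad_self]
  exact JoinedIn.refl (F.pad_mem h hx)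

end Top

section Homotopy

variable [TopologicalSpace B] [IsTopologicalRing B] [ContinuousSMul ℂ B]

lemma joined_conj {n : ℕ} {x : Matrix (Fin n) (Fin n) B} (hx : x ∈ F.carrier n)
    (P : Matrix (Fin n) (Fin n) ℂ) (hs : star P = P) (hP : P * P = 1) :
    JoinedIn (F.carrier n) x
      ((algebraMap ℂ B).mapMatrix P * x * (algebraMap ℂ B).mapMatrix P) := by
  let z : ℝ → ℂ := fun t => Complex.exp (t * Real.pi * Complex.I)
  have hz : ∀ t, star (z t) * z t = 1 := fun t => by
    have : ‖z t‖ = 1 := by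
      have := Complex.norm_exp_ofReal_mul_I (t * Real.pi)
      simpa [z] using this
    rw [mul_comm]
    change z t * (starRingEnd ℂ) (z t) = 1
    rw [Complex.mul_conj, Complex.normSq_eq_norm_sq, this]; simp
  let w : ℝ → Matrix (Fin n) (Fin n) ℂ := fun t =>
    ((1 + z t) / 2) • (1 : Matrix (Fin n) (Fin n) ℂ) + ((1 - z t) / 2) • P
  have hws : ∀ t, star (w t) = ((1 + star (z t)) / 2) • (1 : Matrix (Fin n) (Fin n) ℂ)
      + ((1 - star (z t)) / 2) • P := fun t => by
    simp [w, star_add, star_smul, hs]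
  have key : ∀ a b c d : ℂ, (a • (1 : Matrix (Fin n) (Fin n) ℂ) + b • P) * (c • 1 + d • P)
      = (a * c + b * d) • 1 + (a * d + b * c) • P := fun a b c d => by
    simp only [add_mul, mul_add, smul_mul_assoc, mul_smul_comm, one_mul, mul_one, hP, add_smul,
      smul_add, smul_smul, mul_comm c a, mul_comm c b, mul_comm d a, mul_comm d b]
    abel
  have hw1 : ∀ t, star (w t) * w t = 1 := fun t => by
    rw [hws]
    simp only [w]
    rw [key]
    have h1 : (1 + star (z t)) / 2 * ((1 + z t) / 2) + (1 - star (z t)) / 2 * ((1 - z t) / 2) = 1 := by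
      linear_combination (1 / 2 : ℂ) * hz t
    have h2 : (1 + star (z t)) / 2 * ((1 - z t) / 2) + (1 - star (z t)) / 2 * ((1 + z t) / 2) = 0 := by
      linear_combination (-1 / 2 : ℂ) * hz t
    rw [h1, h2]; simp
  have hw2 : ∀ t, w t * star (w t) = 1 := fun t => mul_eq_one_comm.mp (hw1 t)
  have hzc : Continuous z := by fun_prop
  have hwc : Continuous w := by fun_prop
  have hwsc : Continuous fun t => star (w t) := hwc.star
  have ha : Continuous (algebraMap ℂ B) := continuous_algebraMap ℂ B
  refine JoinedIn.ofLine (f := fun t => (algebraMap ℂ B).mapMatrix (w t) * x *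
    (algebraMap ℂ B).mapMatrix (star (w t))) ?_ ?_ ?_ ?_
  · exact ((hwc.matrix_map ha).mul continuous_const |>.mul (hwsc.matrix_map ha)).continuousOn
  · simp [w, z]
  · have : w 1 = P := by simp [w, z]
    simp only [this, hs]
  · rintro _ ⟨t, _, rfl⟩
    exact F.conj_mem _ (hw1 t) (hw2 t) hx

lemma joined_perm {n : ℕ} (σ : Equiv.Perm (Fin n)) {x : Matrix (Fin n) (Fin n) B}
    (hx : x ∈ F.carrier n) : JoinedIn (F.carrier n) x (x.submatrix σ σ) := by
  induction σ using Equiv.Perm.swap_induction_on' with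
  | one => exact JoinedIn.refl hx
  | mul_swap f i j _ ih =>
    refine ih.trans ?_
    have h := F.joined_conj ih.target_mem ((Equiv.swap i j).permMatrix ℂ)
      (by rw [Matrix.star_eq_conjTranspose, Matrix.conjTranspose_permMatrix, Equiv.swap_inv])
      (by rw [← Matrix.permMatrix_mul, Equiv.swap_mul_self, Matrix.permMatrix_one])
    have e : (algebraMap ℂ B).mapMatrix ((Equiv.swap i j).permMatrix ℂ)
        = (Equiv.swap i j).toPEquiv.toMatrix := by
      ext a b
      simp only [RingHom.mapMatrix_apply, Matrix.map_apply, PEquiv.toMatrix_apply]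
      split_ifs <;> simp
    rw [e, PEquiv.toMatrix_toPEquiv_mul, PEquiv.mul_toMatrix_toPEquiv, Matrix.submatrix_submatrix,
      Matrix.submatrix_submatrix] at h
    simpa using h

lemma rel_of_equiv {n m : ℕ} (σ : Fin n ≃ Fin m) {x : Matrix (Fin n) (Fin n) B}
    {y : Matrix (Fin m) (Fin m) B} (hx : x ∈ F.carrier n) (hy : y ∈ F.carrier m)
    (h : x = y.submatrix σ σ) : F.Rel ⟨n, x, hx⟩ ⟨m, y, hy⟩ := by
  obtain rfl : n = m := by simpa using Fintype.card_congr σ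
  subst h
  exact F.rel_equivalence.symm (F.rel_of_joined (F.joined_perm σ hy))

lemma rel_comm {n m : ℕ} {x : Matrix (Fin n) (Fin n) B} {y : Matrix (Fin m) (Fin m) B}
    (hx : x ∈ F.carrier n) (hy : y ∈ F.carrier m) :
    F.Rel ⟨_, blockSum x y, F.blockSum_mem hx hy⟩ ⟨_, blockSum y x, F.blockSum_mem hy hx⟩ := by
  refine F.rel_of_equiv ((finSumFinEquiv.symm.trans (Equiv.sumComm _ _)).trans finSumFinEquiv)
    _ _ ?_
  ext i j
  obtain ⟨i, rfl⟩ := finSumFinEquiv.surjective i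
  obtain ⟨j, rfl⟩ := finSumFinEquiv.surjective j
  rcases i with i | i <;> rcases j with j | j <;> simp [blockSum]

lemma rel_assoc {n m k : ℕ} {x : Matrix (Fin n) (Fin n) B} {y : Matrix (Fin m) (Fin m) B}
    {z : Matrix (Fin k) (Fin k) B}
    (hx : x ∈ F.carrier n) (hy : y ∈ F.carrier m) (hz : z ∈ F.carrier k) :
    F.Rel ⟨_, blockSum (blockSum x y) z, F.blockSum_mem (F.blockSum_mem hx hy) hz⟩
      ⟨_, blockSum x (blockSum y z), F.blockSum_mem hx (F.blockSum_mem hy hz)⟩ := by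
  let a : (Fin n ⊕ Fin m) ⊕ Fin k ≃ Fin (n + m + k) :=
    (Equiv.sumCongr finSumFinEquiv (Equiv.refl _)).trans finSumFinEquiv
  let b : Fin n ⊕ (Fin m ⊕ Fin k) ≃ Fin (n + (m + k)) :=
    (Equiv.sumCongr (Equiv.refl _) finSumFinEquiv).trans finSumFinEquiv
  refine F.rel_of_equiv ((a.symm.trans (Equiv.sumAssoc _ _ _)).trans b) _ _ ?_
  ext i j
  obtain ⟨i, rfl⟩ := a.surjective i
  obtain ⟨j, rfl⟩ := a.surjective j
  rcases i with (i | i) | i <;> rcases j with (j | j) | j <;> simp [a, b, blockSum]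

lemma rel_add_left {n m k : ℕ} {x : Matrix (Fin n) (Fin n) B} {x' : Matrix (Fin m) (Fin m) B}
    {y : Matrix (Fin k) (Fin k) B} (hx : x ∈ F.carrier n) (hx' : x' ∈ F.carrier m)
    (hy : y ∈ F.carrier k) (h : F.Rel ⟨n, x, hx⟩ ⟨m, x', hx'⟩) :
    F.Rel ⟨_, blockSum x y, F.blockSum_mem hx hy⟩ ⟨_, blockSum x' y, F.blockSum_mem hx' hy⟩ := by
  have step : ∀ {n : ℕ} (x : Matrix (Fin n) (Fin n) B) (hx : x ∈ F.carrier n) (N : ℕ) (hN : n ≤ N),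
      F.Rel ⟨_, blockSum x y, F.blockSum_mem hx hy⟩
        ⟨_, blockSum (pad F.base N x) y, F.blockSum_mem (F.pad_mem hN hx) hy⟩ := by
    intro n x hx N hN
    obtain ⟨l, rfl⟩ := Nat.exists_eq_add_of_le hN
    refine F.rel_equivalence.trans (F.rel_comm hx hy) (F.rel_equivalence.trans
      (F.rel_pad (Nat.le_add_right (k + n) l) (F.blockSum_mem hy hx)) ?_)
    simp only [pad_add]
    exact F.rel_equivalence.trans (F.rel_assoc hy hx (F.diagonal_mem l))
      (F.rel_comm hy (F.blockSum_mem hx (F.diagonal_mem l)))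
  obtain ⟨N, h1, h2, h⟩ := h
  refine F.rel_equivalence.trans (step x hx N h1)
    (F.rel_equivalence.trans ?_ (F.rel_equivalence.symm (step x' hx' N h2)))
  exact F.rel_of_joined ((h.map (continuous_blockSum_left y)).mono (by
    rintro _ ⟨z, hz, rfl⟩; exact F.blockSum_mem hz hy))

/-- The set of stable homotopy classes. -/
def V : Type _ := Quotient F.setoid

/-- The stable homotopy class of an admissible matrix. -/
def cls {n : ℕ} (x : Matrix (Fin n) (Fin n) B) (hx : x ∈ F.carrier n) : F.V :=
  Quotient.mk F.setoid ⟨n, x, hx⟩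

/-- Addition is induced by the block sum. -/
instance : Add F.V where
  add := Quotient.map₂
    (fun x y => ⟨x.1 + y.1, blockSum x.2.1 y.2.1, F.blockSum_mem x.2.2 y.2.2⟩)
    (by
      intro x x' h y y' h'
      exact F.rel_equivalence.trans (F.rel_add_left x.2.2 x'.2.2 y.2.2 h)
        (F.rel_equivalence.trans (F.rel_comm x'.2.2 y.2.2)
          (F.rel_equivalence.trans (F.rel_add_left y.2.2 y'.2.2 x'.2.2 h')
            (F.rel_comm y'.2.2 x'.2.2))))

/-- The neutral element is the class of `e ⊕ ⋯ ⊕ e` (of any size, in particular of the empty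
sum). -/
instance : Zero F.V where
  zero := F.cls _ (F.diagonal_mem 0)

instance : AddCommMonoid F.V where
  nsmul := nsmulRec
  add_assoc := by
    rintro ⟨x⟩ ⟨y⟩ ⟨z⟩
    exact Quotient.sound (s := F.setoid) (F.rel_assoc x.2.2 y.2.2 z.2.2)
  add_comm := by
    rintro ⟨x⟩ ⟨y⟩
    exact Quotient.sound (s := F.setoid) (F.rel_comm x.2.2 y.2.2)
  zero_add := by
    rintro ⟨x⟩
    refine Quotient.sound (s := F.setoid) (F.rel_equivalence.trans
      (F.rel_comm (F.diagonal_mem 0) x.2.2) (F.rel_equivalence.symm ?_))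
    have := F.rel_pad (Nat.le_add_right x.1 0) x.2.2
    simp only [pad_add] at this
    exact this
  add_zero := by
    rintro ⟨x⟩
    refine Quotient.sound (s := F.setoid) (F.rel_equivalence.symm ?_)
    have := F.rel_pad (Nat.le_add_right x.1 0) x.2.2
    simp only [pad_add] at this
    exact this

lemma cls_add_cls {n m : ℕ} {x : Matrix (Fin n) (Fin n) B} {y : Matrix (Fin m) (Fin m) B}
    (hx : x ∈ F.carrier n) (hy : y ∈ F.carrier m) :
    F.cls x hx + F.cls y hy = F.cls (blockSum x y) (F.blockSum_mem hx hy) := rfl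

lemma cls_eq_of_joined {n : ℕ} {x y : Matrix (Fin n) (Fin n) B}
    (h : JoinedIn (F.carrier n) x y) : F.cls x h.source_mem = F.cls y h.target_mem :=
  Quotient.sound (s := F.setoid) (F.rel_of_joined h)

lemma cls_diagonal (n : ℕ) : F.cls _ (F.diagonal_mem n) = 0 := by
  refine Quotient.sound (s := F.setoid) (F.rel_equivalence.symm ?_)
  have := F.rel_pad (Nat.zero_le n) (F.diagonal_mem 0)
  convert this using 3
  ext i j
  simp [pad, Matrix.diagonal_apply]

/-- If every class has an inverse, the monoid of stable homotopy classes is a group. -/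
@[reducible]
def addCommGroup (h : ∀ a : F.V, ∃ b, b + a = 0) : AddCommGroup F.V where
  neg a := Classical.choose (h a)
  zsmul := @zsmulRec F.V _ _ ⟨fun a => Classical.choose (h a)⟩ nsmulRec
  neg_add_cancel a := Classical.choose_spec (h a)
  add_comm := add_comm

/-- The homomorphism induced by a continuous unital star homomorphism `φ`, applied to each entry,
that maps admissible matrices to admissible matrices and base point to base point. -/
def map {C : Type*} [Ring C] [StarRing C] [Algebra ℂ C] [TopologicalSpace C] [IsTopologicalRing C]
    [ContinuousSMul ℂ C] (G : MatrixFamily C) (φ : B →⋆ₐ[ℂ] C) (hφ : Continuous φ)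
    (hmem : ∀ (n : ℕ) (x : Matrix (Fin n) (Fin n) B), x ∈ F.carrier n → x.map φ ∈ G.carrier n)
    (hbase : φ F.base = G.base) : F.V →+ G.V where
  toFun := Quotient.map (fun x => ⟨x.1, x.2.1.map φ, hmem _ _ x.2.2⟩) (by
    rintro x y ⟨N, h1, h2, h⟩
    refine ⟨N, h1, h2, ?_⟩
    have e : ∀ {n : ℕ} (x : Matrix (Fin n) (Fin n) B),
        (pad F.base N x).map φ = pad G.base N (x.map φ) := by
      intro n x
      ext i j
      simp only [pad, Matrix.map_apply]
      split_ifs <;> simp [hbase]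
    rw [← e, ← e]
    exact (h.map (continuous_id.matrix_map hφ)).mono (by
      rintro _ ⟨z, hz, rfl⟩; exact hmem _ _ hz))
  map_zero' := by
    refine Quotient.sound (s := G.setoid) ?_
    refine G.rel_of_equiv (Equiv.refl _) _ _ ?_
    ext i
    exact i.elim0
  map_add' := by
    rintro ⟨x⟩ ⟨y⟩
    refine Quotient.sound (s := G.setoid) ?_
    refine G.rel_of_equiv (Equiv.refl _) _ (G.blockSum_mem (hmem _ _ x.2.2) (hmem _ _ y.2.2)) ?_
    exact blockSum_map _ _ _ (map_zero φ)

end Homotopy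

end MatrixFamily

end Stable

/-! ## Van Daele's group with base point -/

section Groups

variable {B : Type*} [Ring B] [StarRing B] [Algebra ℂ B] [StarModule ℂ B]

lemma star_mapMatrix {n : ℕ} (w : Matrix (Fin n) (Fin n) ℂ) :
    star ((algebraMap ℂ B).mapMatrix w) = (algebraMap ℂ B).mapMatrix (star w) := by
  ext i j
  exact (algebraMap_star_comm (w j i)).symm

lemma matrix_mapMatrix (γ : Grading B) {n : ℕ} (w : Matrix (Fin n) (Fin n) ℂ) :
    (γ.matrix (Fin n)).aut ((algebraMap ℂ B).mapMatrix w) = (algebraMap ℂ B).mapMatrix w := by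
  ext i j
  change γ.aut (algebraMap ℂ B (w i j)) = algebraMap ℂ B (w i j)
  have h1 : γ.aut 1 = 1 := map_one γ.aut
  rw [Algebra.algebraMap_eq_smul_one, map_smul, h1]

lemma matrix_diagonal (γ : Grading B) (e : B) (n : ℕ) :
    (γ.matrix (Fin n)).aut (Matrix.diagonal fun _ => e) = Matrix.diagonal fun _ => γ.aut e :=
  Matrix.diagonal_map (map_zero γ.aut)

/-- The family of sets `𝔖(M_n(B), γ_n)` of odd self-adjoint unitaries, with base point
`e ∈ 𝔖(B, γ)`. -/
def oddFamily (γ : Grading B) (e : B) (he : e ∈ oddSAU γ) : MatrixFamily B where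
  carrier n := oddSAU (γ.matrix (Fin n))
  base := e
  diagonal_mem n := by
    obtain ⟨h1, h2, h3⟩ := he
    refine ⟨?_, ?_, ?_⟩
    · rw [Matrix.star_eq_conjTranspose, Matrix.diagonal_conjTranspose]
      congr 1; funext i; exact h1
    · rw [Matrix.diagonal_mul_diagonal]; simp [h2]
    · rw [matrix_diagonal, Matrix.diagonal_neg]; simp [h3]
  blockSum_mem := by
    rintro n m x y ⟨h1, h2, h3⟩ ⟨h1', h2', h3'⟩
    refine ⟨?_, ?_, ?_⟩
    · rw [star_blockSum, h1, h1']
    · rw [blockSum_mul, h2, h2', blockSum_one]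
    · have := blockSum_map x y γ.aut (map_zero γ.aut)
      rw [← blockSum_neg, ← h3, ← h3']
      exact this
  conj_mem := by
    rintro n x w hw hw' ⟨h1, h2, h3⟩
    have e1 : (algebraMap ℂ B).mapMatrix (star w) * (algebraMap ℂ B).mapMatrix w = 1 := by
      rw [← map_mul, hw, map_one]
    have e2 : (algebraMap ℂ B).mapMatrix w * (algebraMap ℂ B).mapMatrix (star w) = 1 := by
      rw [← map_mul, hw', map_one]
    refine ⟨?_, ?_, ?_⟩
    · rw [star_mul, star_mul, star_mapMatrix, star_mapMatrix, star_star, h1, mul_assoc]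
    · generalize (algebraMap ℂ B).mapMatrix w = p at *
      generalize (algebraMap ℂ B).mapMatrix (star w) = q at *
      calc p * x * q * (p * x * q) = p * x * (q * p) * x * q := by simp only [mul_assoc]
        _ = p * (x * x) * q := by rw [e1, mul_one]; simp only [mul_assoc]
        _ = 1 := by rw [h2, mul_one, e2]
    · rw [map_mul, map_mul, matrix_mapMatrix, matrix_mapMatrix, h3]; simp

variable [TopologicalSpace B] [IsTopologicalRing B] [ContinuousSMul ℂ B]

lemma joined_of_anticommute (γ : Grading B) {x y : B} (hx : x ∈ oddSAU γ) (hy : y ∈ oddSAU γ)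
    (h : x * y + y * x = 0) : JoinedIn (oddSAU γ) x y := by
  obtain ⟨h1, h2, h3⟩ := hx
  obtain ⟨k1, k2, k3⟩ := hy
  let c : ℝ → ℂ := fun t => (Real.cos (t * (Real.pi / 2)) : ℝ)
  let s : ℝ → ℂ := fun t => (Real.sin (t * (Real.pi / 2)) : ℝ)
  have hc : Continuous c := by fun_prop
  have hs : Continuous s := by fun_prop
  refine JoinedIn.ofLine (f := fun t => c t • x + s t • y) ?_ ?_ ?_ ?_
  · exact ((hc.smul continuous_const).add (hs.smul continuous_const)).continuousOn
  · simp [c, s]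
  · simp [c, s]
  · rintro _ ⟨t, _, rfl⟩
    have hc1 : star (c t) = c t := Complex.conj_ofReal _
    have hs1 : star (s t) = s t := Complex.conj_ofReal _
    have hcs : c t * c t + s t * s t = 1 := by
      have := Real.cos_sq_add_sin_sq (t * (Real.pi / 2))
      simp only [c, s]
      rw [← Complex.ofReal_mul, ← Complex.ofReal_mul, ← Complex.ofReal_add, ← sq, ← sq, this,
        Complex.ofReal_one]
    refine ⟨?_, ?_, ?_⟩
    · rw [star_add, star_smul, star_smul, h1, k1, hc1, hs1]
    · have : (c t • x + s t • y) * (c t • x + s t • y) =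
          (c t * c t) • (x * x) + (s t * s t) • (y * y) + (c t * s t) • (x * y + y * x) := by
        simp only [add_mul, mul_add, smul_mul_assoc, mul_smul_comm, smul_smul, smul_add,
          mul_comm (s t) (c t)]
        abel
      rw [this, h, h2, k2, ← add_smul, hcs]; simp
    · change γ.aut (c t • x + s t • y) = _
      rw [map_add, map_smul, map_smul, h3, k3, smul_neg, smul_neg, neg_add]

/-- Van Daele's group `DK_e(B, γ)` of a graded unital algebra with base point `e`, an odd
self-adjoint unitary which is homotopic to `-e` in `𝔖(B, γ)`. -/
def DKe (γ : Grading B) (e : B) (he : JoinedIn (oddSAU γ) e (-e)) : Type _ :=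
  (oddFamily γ e he.source_mem).V

lemma DKe_exists_neg (γ : Grading B) (e : B) (he : JoinedIn (oddSAU γ) e (-e))
    (a : (oddFamily γ e he.source_mem).V) : ∃ b, b + a = 0 := by
  obtain ⟨n, x, hx⟩ := a
  set F := oddFamily γ e he.source_mem with hF
  have hd := F.diagonal_mem n
  set d : Matrix (Fin n) (Fin n) B := Matrix.diagonal fun _ => F.base with hd0
  have hx' : x ∈ oddSAU (γ.matrix (Fin n)) := hx
  have hd' : d ∈ oddSAU (γ.matrix (Fin n)) := hd
  obtain ⟨h1, h2, h3⟩ := hx'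
  obtain ⟨d1, d2, d3⟩ := hd'
  have hz : -(d * x * d) ∈ F.carrier n := by
    refine ⟨?_, ?_, ?_⟩
    · rw [star_neg, star_mul, star_mul, h1, d1, mul_assoc]
    · calc -(d * x * d) * -(d * x * d) = d * x * (d * d) * x * d := by
            simp only [neg_mul_neg, mul_assoc]
        _ = d * (x * x) * d := by rw [d2, mul_one]; simp only [mul_assoc]
        _ = 1 := by rw [h2, mul_one, d2]
    · rw [map_neg, map_mul, map_mul, h3, d3]; simp
  have hnd : -d ∈ F.carrier n := by
    refine ⟨?_, ?_, ?_⟩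
    · rw [star_neg, d1]
    · rw [neg_mul_neg, d2]
    · rw [map_neg, d3]
  refine ⟨F.cls _ hz, ?_⟩
  change F.cls _ hz + F.cls x hx = 0
  let W : Matrix (Fin (n + n)) (Fin (n + n)) B :=
    Matrix.reindex finSumFinEquiv finSumFinEquiv (Matrix.fromBlocks 0 d d 0)
  have hW : W ∈ oddSAU (γ.matrix (Fin (n + n))) := by
    refine ⟨?_, ?_, ?_⟩
    · simp only [W, Matrix.star_eq_conjTranspose, Matrix.conjTranspose_reindex,
        Matrix.fromBlocks_conjTranspose]
      rw [← Matrix.star_eq_conjTranspose d, d1]; simp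
    · simp only [W, Matrix.reindex_apply, Matrix.submatrix_mul_equiv, Matrix.fromBlocks_multiply]
      simp [d2, Matrix.fromBlocks_one]
    · have h0 : γ.aut 0 = 0 := map_zero γ.aut
      simp only [W]
      generalize (finSumFinEquiv : Fin n ⊕ Fin n ≃ Fin (n + n)) = ψ
      ext i j
      obtain ⟨i, rfl⟩ := ψ.surjective i
      obtain ⟨j, rfl⟩ := ψ.surjective j
      have key := fun i j => congrFun (congrFun d3 i) j
      change γ.aut (Matrix.reindex ψ ψ _ _ _) = -(Matrix.reindex ψ ψ _ _ _)
      rcases i with i | i <;> rcases j with j | j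
      · simp [h0]
      · simpa only [Matrix.reindex_apply, Matrix.submatrix_apply, Equiv.symm_apply_apply,
          Matrix.fromBlocks_apply₁₂] using! key i j
      · simpa only [Matrix.reindex_apply, Matrix.submatrix_apply, Equiv.symm_apply_apply,
          Matrix.fromBlocks_apply₂₁] using! key i j
      · simp [h0]
  have joinW : ∀ y, y ∈ oddSAU (γ.matrix (Fin n)) → (hy : -(d * y * d) ∈ F.carrier n) →
      ∀ hy' : y ∈ F.carrier n,
      JoinedIn (F.carrier (n + n)) (blockSum (-(d * y * d)) y) W := by
    intro y _ hy hy'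
    refine joined_of_anticommute _ (F.blockSum_mem hy hy') hW ?_
    simp only [W, blockSum, Matrix.reindex_apply, Matrix.submatrix_mul_equiv,
      Matrix.fromBlocks_multiply]
    generalize (finSumFinEquiv : Fin n ⊕ Fin n ≃ Fin (n + n)) = ψ
    ext i j
    obtain ⟨i, rfl⟩ := ψ.surjective i
    obtain ⟨j, rfl⟩ := ψ.surjective j
    have a1 : d * y * d * d = d * y := by rw [mul_assoc (d * y), d2, mul_one]
    have a2 : d * (d * y * d) = y * d := by
      rw [← mul_assoc, ← mul_assoc, d2, one_mul]
    rcases i with i | i <;> rcases j with j | j <;> simp [a1, a2]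
  have e1 : d * d * d = d := by rw [d2, one_mul]
  have hnd2 : -(d * d * d) ∈ F.carrier n := by rw [e1]; exact hnd
  rw [F.cls_add_cls, F.cls_eq_of_joined ((joinW x ⟨h1, h2, h3⟩ hz hx).trans
    (joinW d ⟨d1, d2, d3⟩ hnd2 hd).symm), ← F.cls_add_cls hnd2 hd]
  have j : JoinedIn (F.carrier n) d (-d) := by
    have hcont : Continuous fun b : B => Matrix.diagonal fun _ : Fin n => b :=
      (continuous_pi fun _ => continuous_id).matrix_diagonal
    have := (he.map hcont).mono (V := F.carrier n) (by
      rintro _ ⟨z, hz, rfl⟩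
      exact (oddFamily γ z hz).diagonal_mem n)
    rw [← Matrix.diagonal_neg] at this
    exact this
  have e2 : F.cls (-(d * d * d)) hnd2 = 0 := by
    rw [← F.cls_diagonal n]
    have := (F.cls_eq_of_joined j).symm
    convert this using 2
    rw [e1]
  rw [e2, zero_add]
  exact F.cls_diagonal n

instance (γ : Grading B) (e : B) (he : JoinedIn (oddSAU γ) e (-e)) : AddCommGroup (DKe γ e he) :=
  (oddFamily γ e he.source_mem).addCommGroup (DKe_exists_neg γ e he)

/-- The homomorphism `DK_e(B, γ) → DK_{φ(e)}(C, δ)` induced by a continuous unital star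
homomorphism `φ` which intertwines the gradings. -/
def DKe.map {C : Type*} [Ring C] [StarRing C] [Algebra ℂ C] [StarModule ℂ C] [TopologicalSpace C]
    [IsTopologicalRing C] [ContinuousSMul ℂ C] {γ : Grading B} {e : B}
    {he : JoinedIn (oddSAU γ) e (-e)} {δ : Grading C} {f : C} {hf : JoinedIn (oddSAU δ) f (-f)}
    (φ : B →⋆ₐ[ℂ] C) (hφ : Continuous φ) (hγ : ∀ b, φ (γ.aut b) = δ.aut (φ b)) (hef : φ e = f) :
    DKe γ e he →+ DKe δ f hf :=
  (oddFamily γ e he.source_mem).map (oddFamily δ f hf.source_mem) φ hφ (by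
    rintro n x ⟨h1, h2, h3⟩
    refine ⟨?_, ?_, ?_⟩
    · ext i j
      change star (φ (x j i)) = φ (x i j)
      rw [← map_star]
      exact congrArg φ (congrFun (congrFun h1 i) j)
    · have := congrArg (φ : B →+* C).mapMatrix h2
      rw [map_mul, map_one] at this
      exact this
    · ext i j
      change δ.aut (φ (x i j)) = -(φ (x i j))
      rw [← hγ, ← map_neg]
      exact congrArg φ (congrFun (congrFun h3 i) j)) hef

/-- The family of unitary groups `U(M_n(B))`, with base point `1`. -/
def unitaryFamily (B : Type*) [Ring B] [StarRing B] [Algebra ℂ B] [StarModule ℂ B] :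
    MatrixFamily B where
  carrier n := (unitary (Matrix (Fin n) (Fin n) B) : Set (Matrix (Fin n) (Fin n) B))
  base := 1
  diagonal_mem n := by rw [Matrix.diagonal_one]; exact one_mem _
  blockSum_mem := by
    intro n m x y hx hy
    rw [SetLike.mem_coe, Unitary.mem_iff] at *
    rw [star_blockSum, blockSum_mul, blockSum_mul, hx.1, hx.2, hy.1, hy.2]
    exact ⟨blockSum_one, blockSum_one⟩
  conj_mem := by
    intro n x w hw hw' hx
    have e1 : (algebraMap ℂ B).mapMatrix w ∈ unitary (Matrix (Fin n) (Fin n) B) := by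
      rw [Unitary.mem_iff, star_mapMatrix, ← map_mul, ← map_mul, hw, hw', map_one]
      exact ⟨rfl, rfl⟩
    rw [← star_mapMatrix]
    exact mul_mem (mul_mem e1 hx) (Unitary.star_mem e1)

/-- The usual group `KU₁(B)` of a unital algebra: stable homotopy classes of unitaries
in `U(M_n(B))`. -/
def KU1 (B : Type*) [Ring B] [StarRing B] [Algebra ℂ B] [StarModule ℂ B] [TopologicalSpace B]
    [IsTopologicalRing B] [ContinuousSMul ℂ B] : Type _ :=
  (unitaryFamily B).V

lemma KU1_exists_neg (a : (unitaryFamily B).V) : ∃ b, b + a = 0 := by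
  obtain ⟨n, x, hx⟩ := a
  set F := unitaryFamily B with hF
  have hs : star x ∈ F.carrier n := Unitary.star_mem hx
  have h1 : (1 : Matrix (Fin n) (Fin n) B) ∈ F.carrier n := one_mem _
  refine ⟨F.cls _ hs, ?_⟩
  change F.cls _ hs + F.cls x hx = 0
  let σ : Equiv.Perm (Fin (n + n)) :=
    (finSumFinEquiv.symm.trans (Equiv.sumComm _ _)).trans finSumFinEquiv
  have j := F.joined_perm σ (F.blockSum_mem h1 hx)
  have e : (blockSum 1 x).submatrix σ σ = blockSum x (1 : Matrix (Fin n) (Fin n) B) := by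
    simp only [blockSum, σ]
    generalize (finSumFinEquiv : Fin n ⊕ Fin n ≃ Fin (n + n)) = ψ
    ext i j
    obtain ⟨i, rfl⟩ := ψ.surjective i
    obtain ⟨j, rfl⟩ := ψ.surjective j
    rcases i with i | i <;> rcases j with j | j <;> simp
  rw [e] at j
  have hc : Continuous fun y : Matrix (Fin (n + n)) (Fin (n + n)) B => blockSum (star x) 1 * y :=
    continuous_const.mul continuous_id
  have j2 := (j.map hc).mono (V := F.carrier (n + n)) (by
    rintro _ ⟨z, hz, rfl⟩
    exact mul_mem (F.blockSum_mem hs h1) hz)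
  have hx1 : star x * x = 1 := (Unitary.mem_iff.mp hx).1
  rw [blockSum_mul, blockSum_mul, one_mul, mul_one, one_mul, hx1, blockSum_one] at j2
  rw [F.cls_add_cls, F.cls_eq_of_joined j2, ← F.cls_diagonal (n + n)]
  congr 1

instance : AddCommGroup (KU1 B) := (unitaryFamily B).addCommGroup KU1_exists_neg

/-- The homomorphism `KU₁(B) → KU₁(C)` induced by a continuous unital star homomorphism. -/
def KU1.map {C : Type*} [Ring C] [StarRing C] [Algebra ℂ C] [StarModule ℂ C] [TopologicalSpace C]
    [IsTopologicalRing C] [ContinuousSMul ℂ C] (φ : B →⋆ₐ[ℂ] C) (hφ : Continuous φ) :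
    KU1 B →+ KU1 C :=
  (unitaryFamily B).map (unitaryFamily C) φ hφ (by
    intro n x hx
    have h := Unitary.mem_iff.mp hx
    have hs : star (x.map φ) = (star x).map φ := by
      ext i j; simp [Matrix.star_apply, map_star]
    have a := congrArg (φ : B →+* C).mapMatrix h.1
    have b := congrArg (φ : B →+* C).mapMatrix h.2
    rw [map_mul, map_one] at a b
    refine Unitary.mem_iff.mpr ?_
    rw [hs]
    exact ⟨a, b⟩) (map_one φ)

/-! ## The groups `DK(A, γ)`, `K₁(A, id)` and `KU₁(A)` -/

lemma ev_apply (γ : Grading B) (x : Matrix (Fin 2) (Fin 2) B) :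
    γ.ev.aut x = sigmaZ B * x.map γ.aut * sigmaZ B := rfl

/-- The path from `σ_x` to `-σ_x` through `σ_y`. -/
lemma sigmaX_joined (γ : Grading B) : JoinedIn (oddSAU γ.ev) (sigmaX B) (-sigmaX B) := by
  let J : B := algebraMap ℂ B Complex.I
  have hJ : γ.aut J = J := by
    have h1 : γ.aut 1 = 1 := map_one γ.aut
    simp only [J]
    rw [Algebra.algebraMap_eq_smul_one, map_smul, h1]
  have hJ2 : J * J = -1 := by
    simp only [J]
    rw [← map_mul, Complex.I_mul_I, map_neg, map_one]
  have hJs : star J = -J := by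
    simp only [J]
    rw [← algebraMap_star_comm, ← map_neg]; congr 1; simp
  have h1 : γ.aut 1 = 1 := map_one γ.aut
  have h0 : γ.aut 0 = 0 := map_zero γ.aut
  let Y : Matrix (Fin 2) (Fin 2) B := !![0, -J; J, 0]
  have hX : sigmaX B ∈ oddSAU γ.ev := by
    refine ⟨?_, ?_, ?_⟩
    · ext i j; fin_cases i <;> fin_cases j <;> simp [sigmaX, Matrix.star_apply]
    · ext i j; fin_cases i <;> fin_cases j <;> simp [sigmaX, Matrix.mul_apply]
    · rw [ev_apply]
      ext i j
      fin_cases i <;> fin_cases j <;> 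
        simp [sigmaX, sigmaZ, Matrix.mul_apply, Matrix.vecMul, dotProduct, Fin.sum_univ_two, h0, h1]
  have hX' : -sigmaX B ∈ oddSAU γ.ev := by
    obtain ⟨a, b, c⟩ := hX
    exact ⟨by rw [star_neg, a], by rw [neg_mul_neg, b], by rw [map_neg, c]⟩
  have hY : Y ∈ oddSAU γ.ev := by
    refine ⟨?_, ?_, ?_⟩
    · ext i j; fin_cases i <;> fin_cases j <;> simp [Y, Matrix.star_apply, hJs]
    · ext i j; fin_cases i <;> fin_cases j <;> simp [Y, Matrix.mul_apply, hJ2]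
    · rw [ev_apply]
      ext i j
      fin_cases i <;> fin_cases j <;> 
        simp [Y, sigmaZ, Matrix.mul_apply, Matrix.vecMul, dotProduct, Fin.sum_univ_two, h0, hJ]
  have hXY : sigmaX B * Y + Y * sigmaX B = 0 := by
    ext i j; fin_cases i <;> fin_cases j <;> simp [Y, sigmaX]
  refine (joined_of_anticommute _ hX hY hXY).trans (joined_of_anticommute _ hY hX' ?_)
  rw [mul_neg, neg_mul, ← neg_add, add_comm, hXY, neg_zero]

/-- Van Daele's group `DK(B, γ) = DK_{σ_x}(M₂(B), γ_ev)` of a graded unital algebra. -/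
def DK (γ : Grading B) : Type _ := DKe γ.ev (sigmaX B) (sigmaX_joined γ)

instance (γ : Grading B) : AddCommGroup (DK γ) :=
  inferInstanceAs (AddCommGroup (DKe γ.ev (sigmaX B) (sigmaX_joined γ)))

/-- Entrywise application of a star homomorphism to `2 × 2` matrices. -/
def matrixHom {C : Type*} [Ring C] [StarRing C] [Algebra ℂ C] (φ : B →⋆ₐ[ℂ] C) :
    Matrix (Fin 2) (Fin 2) B →⋆ₐ[ℂ] Matrix (Fin 2) (Fin 2) C where
  toAlgHom := (φ : B →ₐ[ℂ] C).mapMatrix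
  map_star' x := by ext i j; simp [Matrix.star_apply, map_star]

/-- The homomorphism `DK(B, γ) → DK(C, δ)` induced by a continuous unital star homomorphism which
intertwines the gradings. -/
def DK.map {C : Type*} [Ring C] [StarRing C] [Algebra ℂ C] [StarModule ℂ C] [TopologicalSpace C]
    [IsTopologicalRing C] [ContinuousSMul ℂ C] {γ : Grading B} {δ : Grading C}
    (φ : B →⋆ₐ[ℂ] C) (hφ : Continuous φ) (hγ : ∀ b, φ (γ.aut b) = δ.aut (φ b)) :
    DK γ →+ DK δ :=
  DKe.map (matrixHom φ) (continuous_id.matrix_map hφ)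
    (by
      intro x
      have hz : matrixHom φ (sigmaZ B) = sigmaZ C := by
        ext i j; fin_cases i <;> fin_cases j <;> simp [matrixHom, sigmaZ]
      rw [ev_apply, ev_apply, map_mul, map_mul, hz]
      congr 2
      ext i j
      exact hγ _)
    (by ext i j; fin_cases i <;> fin_cases j <;> simp [matrixHom, sigmaX])

/-- The Pauli matrices `σ_x`, `σ_y` satisfy the Clifford relations and generate `M₂(ℂ)`, which
therefore is the Clifford algebra `ℂl₂`; they are odd for `Ad_{σ_z}`. -/
lemma pauli_clifford :
    let y : Matrix (Fin 2) (Fin 2) ℂ := !![0, -Complex.I; Complex.I, 0]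
    sigmaX ℂ ∈ oddSAU (Grading.trivial ℂ).ev ∧ y ∈ oddSAU (Grading.trivial ℂ).ev ∧
      sigmaX ℂ * y + y * sigmaX ℂ = 0 ∧ Algebra.adjoin ℂ {sigmaX ℂ, y} = ⊤ := by
  intro y
  refine ⟨(sigmaX_joined _).source_mem, ⟨?_, ?_, ?_⟩, ?_, ?_⟩
  · ext i j; fin_cases i <;> fin_cases j <;> simp [y, Matrix.star_apply]
  · ext i j; fin_cases i <;> fin_cases j <;> simp [y]
  · have h0 : ∀ z, (Grading.trivial ℂ).aut z = z := fun _ => rfl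
    rw [ev_apply]
    ext i j
    fin_cases i <;> fin_cases j <;>
      simp [y, sigmaZ, Matrix.mul_apply, Matrix.vecMul, dotProduct, Fin.sum_univ_two, h0]
  · ext i j; fin_cases i <;> fin_cases j <;> simp [y, sigmaX]
  · rw [eq_top_iff]
    intro m _
    have hx : sigmaX ℂ ∈ Algebra.adjoin ℂ {sigmaX ℂ, y} := Algebra.subset_adjoin (by simp)
    have hy : y ∈ Algebra.adjoin ℂ {sigmaX ℂ, y} := Algebra.subset_adjoin (by simp)
    have e : m = ((m 0 0 + m 1 1) / 2) • (1 : Matrix (Fin 2) (Fin 2) ℂ)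
        + ((m 0 1 + m 1 0) / 2) • sigmaX ℂ + ((m 0 1 - m 1 0) * Complex.I / 2) • y
        + (-(m 0 0 - m 1 1) * Complex.I / 2) • (sigmaX ℂ * y) := by
      have hI := Complex.I_mul_I
      ext i j
      fin_cases i <;> fin_cases j <;> simp [y, sigmaX]
      · linear_combination ((m 0 0 - m 1 1) / 2) * hI
      · linear_combination ((m 0 1 - m 1 0) / 2) * hI
      · linear_combination (-(m 0 1 - m 1 0) / 2) * hI
      · linear_combination (-(m 0 0 - m 1 1) / 2) * hI
    rw [e]
    exact add_mem (add_mem (add_mem (Subalgebra.smul_mem _ (one_mem _) _)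
      (Subalgebra.smul_mem _ hx _)) (Subalgebra.smul_mem _ hy _))
      (Subalgebra.smul_mem _ (mul_mem hx hy) _)

variable (B) in
/-- The complex Clifford algebra `ℂl₂`, generated by the odd anticommuting self-adjoint unitaries
`σ_x` and `σ_y`, is `M₂(ℂ)` with the grading `st = Ad_{σ_z}`. So `B ⊗ ℂl₂` is `M₂(B)`, and this is
its grading `id ⊗ st`. -/
abbrev cliffordGrading : Grading (Matrix (Fin 2) (Fin 2) B) := (Grading.trivial B).ev

variable (B) in
/-- `K₁(B, id) = DK_e(B ⊗ ℂl₂, id ⊗ st)` of a trivially graded unital algebra, with the odd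
self-adjoint unitary `e = 1 ⊗ σ_x`. -/
def K1 : Type _ := DKe (cliffordGrading B) (sigmaX B) (sigmaX_joined (Grading.trivial B))

instance : AddCommGroup (K1 B) :=
  inferInstanceAs (AddCommGroup
    (DKe (cliffordGrading B) (sigmaX B) (sigmaX_joined (Grading.trivial B))))

/-- The homomorphism `K₁(B, id) → K₁(C, id)` induced by a continuous unital star homomorphism. -/
def K1.map {C : Type*} [Ring C] [StarRing C] [Algebra ℂ C] [StarModule ℂ C] [TopologicalSpace C]
    [IsTopologicalRing C] [ContinuousSMul ℂ C] (φ : B →⋆ₐ[ℂ] C) (hφ : Continuous φ) :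
    K1 B →+ K1 C :=
  DK.map (γ := Grading.trivial B) (δ := Grading.trivial C) φ hφ fun _ => rfl

end Groups

/-! ## Algebras without unit

For a C⋆-algebra `A`, with or without unit, `A⁺ = Unitization ℂ A` is the C⋆-algebra obtained by
adding a unit. The groups of `A` are the kernels of the maps induced by `A⁺ → ℂ`. -/

section Nonunital

variable {A : Type*} [NonUnitalCStarAlgebra A]

/-- The extension `γ⁺` of a grading to `A⁺`. -/
def Grading.unitization (γ : Grading A) : Grading (Unitization ℂ A) :=
  have h : ∀ x, Unitization.starMap (γ.aut : A →⋆ₙₐ[ℂ] A)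
      (Unitization.starMap (γ.aut : A →⋆ₙₐ[ℂ] A) x) = x := fun x => by
    induction x using Unitization.ind with
    | inl_add_inr r a => simp [Unitization.algebraMap_eq_inl, γ.invol]
  { aut :=
    { toFun := Unitization.starMap (γ.aut : A →⋆ₙₐ[ℂ] A)
      invFun := Unitization.starMap (γ.aut : A →⋆ₙₐ[ℂ] A)
      left_inv := h
      right_inv := h
      map_mul' := map_mul _
      map_add' := map_add _
      map_star' := map_star _
      map_smul' := map_smul _ }
    invol := h }

variable (A) in
/-- The canonical homomorphism `A⁺ → ℂ` with kernel `A`. -/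
def augmentation : Unitization ℂ A →⋆ₐ[ℂ] ℂ where
  toAlgHom := Unitization.fstHom ℂ A
  map_star' _ := rfl

lemma continuous_augmentation : Continuous (augmentation A) :=
  AddMonoidHomClass.continuous_of_bound (augmentation A) 1 fun x => by
    simpa using NonUnitalStarAlgHom.norm_apply_le (augmentation A) x

lemma augmentation_unitization (γ : Grading A) (x : Unitization ℂ A) :
    augmentation A (γ.unitization.aut x) = (Grading.trivial ℂ).aut (augmentation A x) := by
  change (Unitization.starMap (γ.aut : A →⋆ₙₐ[ℂ] A) x).fst = x.fst
  induction x using Unitization.ind with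
  | inl_add_inr r a => simp [Unitization.algebraMap_eq_inl]

/-- `DK(A, γ)` for a not necessarily unital `A`. -/
def DKNonunital (γ : Grading A) : Type _ :=
  (DK.map (δ := Grading.trivial ℂ) (augmentation A) continuous_augmentation
    (augmentation_unitization γ)).ker

instance (γ : Grading A) : AddCommGroup (DKNonunital γ) :=
  inferInstanceAs (AddCommGroup (AddMonoidHom.ker _))

variable (A) in
/-- `K₁(A, id)` for a not necessarily unital `A`. -/
def K1Nonunital : Type _ := (K1.map (augmentation A) continuous_augmentation).ker

instance : AddCommGroup (K1Nonunital A) :=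
  inferInstanceAs (AddCommGroup (AddMonoidHom.ker _))

variable (A) in
/-- `KU₁(A)` for a not necessarily unital `A`. -/
def KU1Nonunital : Type _ := (KU1.map (augmentation A) continuous_augmentation).ker

instance : AddCommGroup (KU1Nonunital A) :=
  inferInstanceAs (AddCommGroup (AddMonoidHom.ker _))

end Nonunital

end VanDaele

end

/-! The groups `K1` and `KU1` agree already at the level of matrices. A self-adjoint unitary of
M_n(B ⊗ ℂl₂) that is odd for Ad_{σ_z} vanishes on the diagonal corners and has adjoint off-diagonal
corners, so it is (0, u*; u, 0) with a unitary u of M_n(B). This correspondence is continuous in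
both directions, respects block sums and takes σ_x ⊕ ⋯ ⊕ σ_x to 1 (`K1.equivKU1`).

For `DK` and `K1`, write Γ = p − q with projections p + q = 1. The grading γ_ev is implemented by Γ
⊗ σ_z, and W = p ⊗ 1 + q ⊗ σ_x (`intertwiner`) is a self-adjoint unitary that conjugates Γ ⊗ σ_z
into 1 ⊗ σ_z and commutes with the base point 1 ⊗ σ_x. Hence Ad_W exchanges the odd self-adjoint
unitaries of the two gradings (`twistEquiv`, `relEquivOfInner`), provided that it does not leave the
algebra. For unital A this is automatic, because A is an ideal of its multiplier algebra.

For A⁺ the element W has entries in 𝓜(A) × ℂ, and Ad_W may move scalar matrices out of M₂(A⁺). It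
does preserve the ideal M₂(A) and fix σ_x, so it acts on those matrices that differ from σ_x ⊕ ⋯ ⊕
σ_x by entries in M₂(A). Restricting to them does not change the group (`relAugEquiv`): the scalar
part of any odd self-adjoint unitary is (0, u*; u, 0) with u ∈ U(M_n(ℂ)), conjugation with diag(1,
u) normalises it continuously, and a path from 1 to u joins the matrix to its normalisation
(`joinedIn_unitary_complex`).

Connectedness of U(M_n(ℂ)) also makes `KU1 ℂ`, and therefore `K1 ℂ`, trivial. The kernels that
define the nonunital groups are thus the whole groups of A⁺. -/

noncomputable section

namespace VanDaele

/-! ### Isomorphisms of stable homotopy classes induced by maps of matrices -/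

namespace MatrixFamily

variable {B C : Type*} [Ring B] [StarRing B] [Algebra ℂ B] [TopologicalSpace B]
  [IsTopologicalRing B] [ContinuousSMul ℂ B] [Ring C] [StarRing C] [Algebra ℂ C]
  [TopologicalSpace C] [IsTopologicalRing C] [ContinuousSMul ℂ C]

/-- Size-preserving continuous maps between two matrix families that are compatible with block
sums and base points. -/
structure Hom (F : MatrixFamily B) (G : MatrixFamily C) where
  /-- the map on matrices of size `n` -/
  toFun : ∀ n : ℕ, Matrix (Fin n) (Fin n) B → Matrix (Fin n) (Fin n) C
  mapsTo : ∀ n, Set.MapsTo (toFun n) (F.carrier n) (G.carrier n)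
  continuousOn : ∀ n, ContinuousOn (toFun n) (F.carrier n)
  map_diagonal : ∀ n, toFun n (Matrix.diagonal fun _ => F.base) = Matrix.diagonal fun _ => G.base
  map_blockSum : ∀ {n m : ℕ} {x : Matrix (Fin n) (Fin n) B} {y : Matrix (Fin m) (Fin m) B},
    x ∈ F.carrier n → y ∈ F.carrier m →
      toFun (n + m) (blockSum x y) = blockSum (toFun n x) (toFun m y)

variable {F : MatrixFamily B} {G : MatrixFamily C}

lemma Hom.map_pad (f : Hom F G) {n N : ℕ} (h : n ≤ N) {x : Matrix (Fin n) (Fin n) B}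
    (hx : x ∈ F.carrier n) : f.toFun N (pad F.base N x) = pad G.base N (f.toFun n x) := by
  obtain ⟨k, rfl⟩ := Nat.exists_eq_add_of_le h
  rw [pad_add, pad_add, f.map_blockSum hx (F.diagonal_mem k), f.map_diagonal]

/-- The homomorphism of stable homotopy classes induced by a map of matrix families. -/
def Hom.toAddMonoidHom (f : Hom F G) : F.V →+ G.V where
  toFun := Quotient.map (fun x => ⟨x.1, f.toFun _ x.2.1, f.mapsTo _ x.2.2⟩) (by
    rintro x y ⟨N, h1, h2, h⟩
    refine ⟨N, h1, h2, ?_⟩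
    rw [← f.map_pad h1 x.2.2, ← f.map_pad h2 y.2.2]
    exact (h.map_continuousOn (f.continuousOn N)).mono (f.mapsTo N).image_subset)
  map_zero' := by
    refine Quotient.sound (s := G.setoid) ?_
    refine G.rel_of_equiv (Equiv.refl _) _ _ ?_
    ext i
    exact i.elim0
  map_add' := by
    rintro ⟨x⟩ ⟨y⟩
    refine Quotient.sound (s := G.setoid) ?_
    exact G.rel_of_equiv (Equiv.refl _) _ (G.blockSum_mem (f.mapsTo _ x.2.2) (f.mapsTo _ y.2.2))
      (f.map_blockSum x.2.2 y.2.2)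

/-- Mutually inverse maps of matrix families induce an isomorphism. -/
def addEquivOfHoms (f : Hom F G) (g : Hom G F)
    (hgf : ∀ n, ∀ x ∈ F.carrier n, g.toFun n (f.toFun n x) = x)
    (hfg : ∀ n, ∀ x ∈ G.carrier n, f.toFun n (g.toFun n x) = x) : F.V ≃+ G.V where
  toFun := f.toAddMonoidHom
  invFun := g.toAddMonoidHom
  left_inv := by
    rintro ⟨n, x, hx⟩
    change F.cls _ (g.mapsTo n (f.mapsTo n hx)) = F.cls x hx
    simp only [hgf n x hx]
  right_inv := by
    rintro ⟨n, x, hx⟩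
    change G.cls _ (f.mapsTo n (g.mapsTo n hx)) = G.cls x hx
    simp only [hfg n x hx]
  map_add' := map_add f.toAddMonoidHom

end MatrixFamily

/-! ## Unitary groups of complex matrices -/

section Connected

-- For a unitary, −1 is outside the spectrum exactly when its operator-norm distance from 1 is less
-- than 2, and unitaries at such a distance are joined by a path. The operator norm serves only as a
-- tool: its topology on M_n(ℂ) is the entrywise one.
open scoped Matrix.Norms.L2Operator in
lemma joinedIn_unitary_of_spectrum {n : ℕ} {u : Matrix (Fin n) (Fin n) ℂ}
    (hu : u ∈ unitary (Matrix (Fin n) (Fin n) ℂ)) (h : -1 ∉ spectrum ℂ u) :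
    JoinedIn (unitary (Matrix (Fin n) (Fin n) ℂ) : Set (Matrix (Fin n) (Fin n) ℂ)) 1 u := by
  let _ : CStarAlgebra (Matrix (Fin n) (Fin n) ℂ) := {}
  have h1 : ‖u - 1‖ < 2 := (Unitary.norm_sub_one_lt_two_iff hu).mpr h
  have := Unitary.joined (1 : unitary (Matrix (Fin n) (Fin n) ℂ)) ⟨u, hu⟩ h1
  exact (joinedIn_iff_joined (x_in := one_mem _) (y_in := hu)).mpr this

/-- The unitary group of `M_n(ℂ)` is path connected. -/
lemma joinedIn_unitary_complex {n : ℕ} {u : Matrix (Fin n) (Fin n) ℂ}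
    (hu : u ∈ unitary (Matrix (Fin n) (Fin n) ℂ)) :
    JoinedIn (unitary (Matrix (Fin n) (Fin n) ℂ) : Set (Matrix (Fin n) (Fin n) ℂ)) 1 u := by
  have hfin : (spectrum ℂ u).Finite := by
    rw [← Matrix.spectrum_toLin']
    exact Module.End.finite_spectrum _
  have hcirc : ∀ z : Circle, (z : ℂ) • u ∈ unitary (Matrix (Fin n) (Fin n) ℂ) := fun z => by
    have hz : star (z : ℂ) * z = 1 := by
      have := Circle.normSq_coe z
      change (starRingEnd ℂ) (z : ℂ) * z = 1
      rw [mul_comm, Complex.mul_conj, this, Complex.ofReal_one]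
    have hz' : (z : ℂ) * star (z : ℂ) = 1 := by rw [mul_comm, hz]
    rw [Unitary.mem_iff] at hu ⊢
    rw [star_smul, smul_mul_smul_comm, smul_mul_smul_comm, hu.1, hu.2, hz, hz', one_smul]
    exact ⟨rfl, rfl⟩
  -- A finite spectrum misses some point of the circle, written as −e^{it}. Rotating by e^{−it}
  -- moves that gap to −1, and the rotation is itself a path of unitaries.
  obtain ⟨t, ht⟩ : ∃ t : ℝ, -(Circle.exp t : ℂ) ∉ spectrum ℂ u := by
    by_contra! H
    have hinj : Set.InjOn (fun t : ℝ => -(Circle.exp t : ℂ)) (Set.Ioo (-Real.pi) Real.pi) := by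
      intro s hs t ht h
      rw [← Circle.arg_exp hs.1 hs.2.le, ← Circle.arg_exp ht.1 ht.2.le, neg_injective h]
    exact ((Set.Ioo_infinite (by linarith [Real.pi_pos])).image hinj)
      (hfin.subset (by rintro _ ⟨t, _, rfl⟩; exact H t))
  let f : ℝ → Matrix (Fin n) (Fin n) ℂ := fun s => (Circle.exp (-(s * t)) : ℂ) • u
  have hf : Continuous f := by
    have : Continuous fun s : ℝ => (Circle.exp (-(s * t)) : ℂ) := by fun_prop
    exact this.smul continuous_const
  have j1 : JoinedIn (unitary (Matrix (Fin n) (Fin n) ℂ) : Set (Matrix (Fin n) (Fin n) ℂ)) u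
      (f 1) := by
    refine JoinedIn.ofLine hf.continuousOn ?_ rfl ?_
    · simp [f]
    · rintro _ ⟨s, _, rfl⟩
      exact hcirc _
  -- If −1 were in the spectrum of e^{−it}u, then −e^{it} would be in the spectrum of u, against the
  -- choice of t.
  refine (joinedIn_unitary_of_spectrum (hcirc (Circle.exp (-(1 * t)))) fun h => ht ?_).trans j1.symm
  have hz : (Circle.exp (-(1 * t)) : ℂ) ≠ 0 := Circle.coe_ne_zero _
  have key := (spectrum.smul_mem_smul_iff (R := ℂ) (a := u) (s := -(Circle.exp t : ℂ))
    (r := Units.mk0 _ hz)).mp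
  apply key
  have e : (Units.mk0 _ hz) • (-(Circle.exp t : ℂ)) = -1 := by
    rw [Units.smul_def, Units.val_mk0, smul_neg, smul_eq_mul, ← Circle.coe_mul, ← Circle.exp_add]
    simp
  rw [e]
  exact h

end Connected

lemma KU1_complex_subsingleton : Subsingleton (KU1 ℂ) := by
  refine subsingleton_of_forall_eq 0 ?_
  rintro ⟨n, x, hx⟩
  have := (unitaryFamily ℂ).cls_eq_of_joined (joinedIn_unitary_complex hx)
  refine this.symm.trans ?_
  have h := (unitaryFamily ℂ).cls_diagonal n
  have e : (Matrix.diagonal fun _ : Fin n => (unitaryFamily ℂ).base) = 1 := Matrix.diagonal_one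
  simp only [e] at h
  exact h

/-! ## Diagonal and off-diagonal matrices in `M_n(M₂(B))` -/

section DiagBlocks

variable {B : Type*} [Ring B] {n m : ℕ}

/-- The matrix of `M_n(M₂(B))` that corresponds to `diag(a, b)` in `M₂(M_n(B))`. -/
def diagBlocks (a b : Matrix (Fin n) (Fin n) B) :
    Matrix (Fin n) (Fin n) (Matrix (Fin 2) (Fin 2) B) :=
  fun i j => !![a i j, 0; 0, b i j]

variable (B n) in
/-- The matrix `σ_x ⊕ ⋯ ⊕ σ_x`. -/
def sigmaXs : Matrix (Fin n) (Fin n) (Matrix (Fin 2) (Fin 2) B) :=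
  Matrix.diagonal fun _ => sigmaX B

lemma diagBlocks_mul (a b a' b' : Matrix (Fin n) (Fin n) B) :
    diagBlocks a b * diagBlocks a' b' = diagBlocks (a * a') (b * b') := by
  ext i j k l
  rw [Matrix.mul_apply, Matrix.sum_apply]
  fin_cases k <;> fin_cases l <;> simp [diagBlocks, Matrix.mul_apply]

lemma diagBlocks_one : diagBlocks (1 : Matrix (Fin n) (Fin n) B) 1 = 1 := by
  ext i j k l
  by_cases h : i = j
  · subst h; fin_cases k <;> fin_cases l <;> simp [diagBlocks]
  · fin_cases k <;> fin_cases l <;> simp [diagBlocks, Matrix.one_apply_ne h]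

lemma star_diagBlocks [StarRing B] (a b : Matrix (Fin n) (Fin n) B) :
    star (diagBlocks a b) = diagBlocks (star a) (star b) := by
  ext i j k l
  fin_cases k <;> fin_cases l <;> simp [diagBlocks, Matrix.star_apply]

lemma sigmaX_mul_self : sigmaX B * sigmaX B = 1 := by
  ext i j; fin_cases i <;> fin_cases j <;> simp [sigmaX, Matrix.mul_apply]

lemma star_sigmaX [StarRing B] : star (sigmaX B) = sigmaX B := by
  ext i j; fin_cases i <;> fin_cases j <;> simp [sigmaX, Matrix.star_apply]

lemma sigmaXs_mul_self : sigmaXs B n * sigmaXs B n = 1 := by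
  simp [sigmaXs, sigmaX_mul_self]

lemma star_sigmaXs [StarRing B] : star (sigmaXs B n) = sigmaXs B n := by
  simp only [sigmaXs, Matrix.star_eq_conjTranspose, Matrix.diagonal_conjTranspose]
  congr 1; funext i; exact star_sigmaX

lemma diagBlocks_mul_sigmaXs_apply (a b : Matrix (Fin n) (Fin n) B) (i j : Fin n) :
    (diagBlocks a b * sigmaXs B n) i j = !![0, a i j; b i j, 0] := by
  rw [sigmaXs, Matrix.mul_diagonal]
  ext k l
  fin_cases k <;> fin_cases l <;> simp [diagBlocks, sigmaX, Matrix.mul_apply]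

/-- Conjugation with σ_x swaps the two diagonal corners. This rule reduces every product of
off-diagonal matrices below to a product of diagonal ones. -/
lemma sigmaXs_mul_diagBlocks (a b : Matrix (Fin n) (Fin n) B) :
    sigmaXs B n * diagBlocks a b = diagBlocks b a * sigmaXs B n := by
  ext i j : 1
  rw [diagBlocks_mul_sigmaXs_apply, sigmaXs, Matrix.diagonal_mul]
  ext k l
  fin_cases k <;> fin_cases l <;> simp [diagBlocks, sigmaX, Matrix.mul_apply]

lemma diagBlocks_blockSum (a b : Matrix (Fin n) (Fin n) B) (a' b' : Matrix (Fin m) (Fin m) B) :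
    diagBlocks (blockSum a a') (blockSum b b') =
      blockSum (diagBlocks a b) (diagBlocks a' b') := by
  ext i j k l
  obtain ⟨i, rfl⟩ := finSumFinEquiv.surjective i
  obtain ⟨j, rfl⟩ := finSumFinEquiv.surjective j
  rcases i with i | i <;> rcases j with j | j <;> fin_cases k <;> fin_cases l <;>
    simp [diagBlocks, blockSum]

lemma sigmaXs_add : sigmaXs B (n + m) = blockSum (sigmaXs B n) (sigmaXs B m) := by
  ext i j : 1
  obtain ⟨i, rfl⟩ := finSumFinEquiv.surjective i
  obtain ⟨j, rfl⟩ := finSumFinEquiv.surjective j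
  rcases i with i | i <;> rcases j with j | j <;>
    simp [sigmaXs, blockSum, Matrix.diagonal_apply, Fin.ext_iff] <;> omega

lemma continuous_diagBlocks [TopologicalSpace B] :
    Continuous fun p : Matrix (Fin n) (Fin n) B × Matrix (Fin n) (Fin n) B =>
      diagBlocks p.1 p.2 := by
  refine continuous_matrix fun i j => continuous_matrix fun k l => ?_
  have h1 : Continuous fun p : Matrix (Fin n) (Fin n) B × Matrix (Fin n) (Fin n) B => p.1 i j :=
    continuous_fst.matrix_elem i j
  have h2 : Continuous fun p : Matrix (Fin n) (Fin n) B × Matrix (Fin n) (Fin n) B => p.2 i j :=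
    continuous_snd.matrix_elem i j
  fin_cases k <;> fin_cases l
  · exact h1
  · exact continuous_const
  · exact continuous_const
  · exact h2

/-- The matrix in `M_n(B)` of the lower left corners of the entries. -/
def lowerLeft (x : Matrix (Fin n) (Fin n) (Matrix (Fin 2) (Fin 2) B)) : Matrix (Fin n) (Fin n) B :=
  x.map fun c => c 1 0

lemma continuous_lowerLeft [TopologicalSpace B] :
    Continuous (lowerLeft : Matrix (Fin n) (Fin n) (Matrix (Fin 2) (Fin 2) B) → _) :=
  continuous_id.matrix_map (continuous_id.matrix_elem 1 0)

lemma lowerLeft_diagBlocks_mul (a b : Matrix (Fin n) (Fin n) B) :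
    lowerLeft (diagBlocks a b * sigmaXs B n) = b := by
  ext i j
  rw [lowerLeft, Matrix.map_apply, diagBlocks_mul_sigmaXs_apply]
  rfl

lemma lowerLeft_sigmaXs : lowerLeft (sigmaXs B n) = 1 := by
  simpa [diagBlocks_one] using lowerLeft_diagBlocks_mul (1 : Matrix (Fin n) (Fin n) B) 1

lemma lowerLeft_blockSum (x : Matrix (Fin n) (Fin n) (Matrix (Fin 2) (Fin 2) B))
    (y : Matrix (Fin m) (Fin m) (Matrix (Fin 2) (Fin 2) B)) :
    lowerLeft (blockSum x y) = blockSum (lowerLeft x) (lowerLeft y) :=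
  blockSum_map x y (fun c => c 1 0) rfl

end DiagBlocks

/-! ## The isomorphism between `K₁` and `KU₁` -/

section K1

variable {B : Type*} [Ring B] [StarRing B] [Algebra ℂ B] {n : ℕ}

/-- Moving σ_x past diag(u*, u) swaps the corners, so the adjoint gives the same matrix back and the
square is diag(u*u, uu*). Off-diagonal matrices anticommute with σ_z. -/
lemma diagBlocks_mem_oddSAU {u : Matrix (Fin n) (Fin n) B}
    (hu : u ∈ unitary (Matrix (Fin n) (Fin n) B)) :
    diagBlocks (star u) u * sigmaXs B n ∈ oddSAU ((cliffordGrading B).matrix (Fin n)) := by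
  obtain ⟨h1, h2⟩ := Unitary.mem_iff.mp hu
  refine ⟨?_, ?_, ?_⟩
  · rw [star_mul, star_diagBlocks, star_star, star_sigmaXs, sigmaXs_mul_diagBlocks]
  · rw [mul_assoc, ← mul_assoc (sigmaXs B n), sigmaXs_mul_diagBlocks, mul_assoc, sigmaXs_mul_self,
      mul_one, diagBlocks_mul, h1, h2, diagBlocks_one]
  · have h0 : ∀ b, (Grading.trivial B).aut b = b := fun _ => rfl
    ext i j : 1
    change (Grading.trivial B).ev.aut _ = -((diagBlocks (star u) u * sigmaXs B n) i j)
    rw [diagBlocks_mul_sigmaXs_apply]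
    change sigmaZ B * _ * sigmaZ B = _
    ext k l
    fin_cases k <;> fin_cases l <;>
      simp [sigmaZ, Matrix.mul_apply, Fin.sum_univ_two, Matrix.vecMul, dotProduct,
        Grading.matrix, h0]

/-- Ad_{σ_z} fixes the diagonal corners, so oddness gives b = −b there and hence b = 0 over ℂ.
Self-adjointness determines the upper right corner from the lower left one. -/
lemma eq_diagBlocks_of_mem_oddSAU {x : Matrix (Fin n) (Fin n) (Matrix (Fin 2) (Fin 2) B)}
    (hx : x ∈ oddSAU ((cliffordGrading B).matrix (Fin n))) :
    x = diagBlocks (star (lowerLeft x)) (lowerLeft x) * sigmaXs B n := by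
  obtain ⟨h1, -, h3⟩ := hx
  have h0 : ∀ b, (Grading.trivial B).aut b = b := fun _ => rfl
  have h1' : ∀ i j k l, star (x j i l k) = x i j k l := fun i j k l =>
    congrFun (congrFun (congrFun (congrFun h1 i) j) k) l
  have h3' : ∀ i j, sigmaZ B * (x i j).map (Grading.trivial B).aut * sigmaZ B = -x i j :=
    fun i j => congrFun (congrFun h3 i) j
  have two : ∀ b : B, b = -b → b = 0 := fun b hb => by
    have : (2 : ℂ) • b = 0 := by rw [two_smul]; nth_rw 1 [hb]; exact neg_add_cancel b
    exact (smul_eq_zero_iff_right (two_ne_zero)).mp this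
  ext i j k l
  rw [diagBlocks_mul_sigmaXs_apply]
  have a := congrFun (congrFun (h3' i j) k) l
  fin_cases k <;> fin_cases l <;>
    simp [sigmaZ, Matrix.mul_apply, Fin.sum_univ_two, Matrix.vecMul, dotProduct, h0] at a
  · exact two _ a
  · exact (h1' i j 0 1).symm
  · rfl
  · exact two _ a

/-- With x = diag(u*, u)σ_x, the equation x² = 1 reads diag(u*u, uu*) = 1. -/
lemma lowerLeft_mem_unitary {x : Matrix (Fin n) (Fin n) (Matrix (Fin 2) (Fin 2) B)}
    (hx : x ∈ oddSAU ((cliffordGrading B).matrix (Fin n))) :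
    lowerLeft x ∈ unitary (Matrix (Fin n) (Fin n) B) := by
  have e := eq_diagBlocks_of_mem_oddSAU hx
  have h2 := hx.2.1
  set u := lowerLeft x
  have key : ∀ a b : Matrix (Fin n) (Fin n) B, diagBlocks a b = 1 → a = 1 ∧ b = 1 := by
    intro a b h
    rw [← diagBlocks_one] at h
    refine ⟨?_, ?_⟩
    · ext i j; exact congrFun (congrFun (congrFun (congrFun h i) j) 0) 0
    · ext i j; exact congrFun (congrFun (congrFun (congrFun h i) j) 1) 1
  rw [e, mul_assoc, ← mul_assoc (sigmaXs B n), sigmaXs_mul_diagBlocks, mul_assoc, sigmaXs_mul_self,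
      mul_one, diagBlocks_mul] at h2
  exact Unitary.mem_iff.mpr (key _ _ h2)

variable [StarModule ℂ B] [TopologicalSpace B] [IsTopologicalRing B] [ContinuousSMul ℂ B]

/-- An odd self-adjoint unitary of `M_n(B ⊗ ℂl₂)` is of the form `(0, u*; u, 0)` with a unitary
`u ∈ M_n(B)`. -/
def K1.equivKU1 [ContinuousStar B] : K1 B ≃+ KU1 B :=
  MatrixFamily.addEquivOfHoms
    (F := oddFamily (cliffordGrading B) (sigmaX B) (sigmaX_joined (Grading.trivial B)).source_mem)
    (G := unitaryFamily B)
    { toFun := fun _ => lowerLeft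
      mapsTo := fun _ _ hx => lowerLeft_mem_unitary hx
      continuousOn := fun _ => continuous_lowerLeft.continuousOn
      map_diagonal := fun _ => lowerLeft_sigmaXs.trans Matrix.diagonal_one.symm
      map_blockSum := fun {_ _ x y} _ _ => lowerLeft_blockSum x y }
    { toFun := fun n u => diagBlocks (star u) u * sigmaXs B n
      mapsTo := fun _ _ hu => diagBlocks_mem_oddSAU hu
      continuousOn := fun n => by
        have : Continuous fun u : Matrix (Fin n) (Fin n) B => diagBlocks (star u) u :=
          continuous_diagBlocks.comp (continuous_star.prodMk continuous_id)
        exact (this.mul continuous_const).continuousOn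
      map_diagonal := fun n => by
        change diagBlocks (star (Matrix.diagonal fun _ => 1)) (Matrix.diagonal fun _ => 1) *
          sigmaXs B n = sigmaXs B n
        rw [Matrix.diagonal_one, star_one, diagBlocks_one, one_mul]
      map_blockSum := fun _ _ => by
        rw [star_blockSum, diagBlocks_blockSum, sigmaXs_add, blockSum_mul] }
    (fun _ _ hx => (eq_diagBlocks_of_mem_oddSAU hx).symm)
    (fun _ _ _ => lowerLeft_diagBlocks_mul _ _)

end K1

/-! ## Odd self-adjoint unitaries relative to a subspace -/

section Relative

variable {B : Type*} [Ring B] [StarRing B] [Algebra ℂ B] [StarModule ℂ B]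

/-- The odd self-adjoint unitaries of `M_n(B)` that differ from `e ⊕ ⋯ ⊕ e` by a matrix with
entries in `I`. -/
def relOddFamily (γ : Grading B) (e : B) (he : e ∈ oddSAU γ) (I : Submodule ℂ B) :
    MatrixFamily B where
  carrier n := {x | x ∈ oddSAU (γ.matrix (Fin n)) ∧
    ∀ i j, x i j - Matrix.diagonal (fun _ => e) i j ∈ I}
  base := e
  diagonal_mem n := ⟨(oddFamily γ e he).diagonal_mem n, fun i j => by simp⟩
  blockSum_mem := by
    rintro n m x y ⟨hx, hx'⟩ ⟨hy, hy'⟩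
    refine ⟨(oddFamily γ e he).blockSum_mem hx hy, fun i j => ?_⟩
    have hd : Matrix.diagonal (fun _ : Fin (n + m) => e) =
        blockSum (Matrix.diagonal fun _ : Fin n => e) (Matrix.diagonal fun _ : Fin m => e) := by
      rw [← pad_add]
      ext i j
      simp only [pad, Matrix.diagonal_apply, Fin.ext_iff]
      split_ifs <;> rfl
    rw [hd]
    obtain ⟨i, rfl⟩ := finSumFinEquiv.surjective i
    obtain ⟨j, rfl⟩ := finSumFinEquiv.surjective j
    rcases i with i | i <;> rcases j with j | j
    · simpa [blockSum, Matrix.diagonal_apply] using hx' i j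
    · simp [blockSum]
    · simp [blockSum]
    · simpa [blockSum, Matrix.diagonal_apply] using hy' i j
  conj_mem := by
    rintro n x w hw hw' ⟨hx, hx'⟩
    refine ⟨(oddFamily γ e he).conj_mem w hw hw' hx, fun i j => ?_⟩
    -- The base matrix e ⊕ ⋯ ⊕ e commutes with scalar matrices. Conjugation therefore acts on the
    -- difference alone, whose new entries are linear combinations of the old ones; this is why I
    -- need only be a subspace.
    have hd : (algebraMap ℂ B).mapMatrix w * (Matrix.diagonal fun _ => e) *
        (algebraMap ℂ B).mapMatrix (star w) = Matrix.diagonal fun _ => e := by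
      have hc : (algebraMap ℂ B).mapMatrix w * (Matrix.diagonal fun _ => e) =
          (Matrix.diagonal fun _ => e) * (algebraMap ℂ B).mapMatrix w := by
        ext i j
        simp [Algebra.commutes]
      rw [hc, mul_assoc, ← map_mul, hw', map_one, mul_one]
    rw [← hd, ← Matrix.sub_apply, ← sub_mul, ← mul_sub, Matrix.mul_apply]
    refine Submodule.sum_mem _ fun k _ => ?_
    change _ * algebraMap ℂ B (star w k j) ∈ I
    rw [← Algebra.commutes, ← Algebra.smul_def, Matrix.mul_apply]
    refine Submodule.smul_mem _ _ (Submodule.sum_mem _ fun l _ => ?_)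
    change algebraMap ℂ B (w i l) * _ ∈ I
    rw [← Algebra.smul_def]
    exact Submodule.smul_mem _ _ (hx' l k)

variable [TopologicalSpace B]

/-- Forgetting that a matrix differs from `e ⊕ ⋯ ⊕ e` by a matrix with entries in `I`. -/
def relInclusion (γ : Grading B) (e : B) (he : e ∈ oddSAU γ) (I : Submodule ℂ B) :
    MatrixFamily.Hom (relOddFamily γ e he I) (oddFamily γ e he) where
  toFun _ x := x
  mapsTo _ _ hx := hx.1
  continuousOn _ := continuousOn_id
  map_diagonal _ := rfl
  map_blockSum _ _ := rfl

variable [IsTopologicalRing B] [ContinuousSMul ℂ B]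

/-- With `I = B` there is no condition. -/
def relTopEquiv (γ : Grading B) (e : B) (he : e ∈ oddSAU γ) :
    (relOddFamily γ e he ⊤).V ≃+ (oddFamily γ e he).V :=
  MatrixFamily.addEquivOfHoms (relInclusion γ e he ⊤)
    { toFun := fun _ x => x
      mapsTo := fun _ _ hx => ⟨hx, fun _ _ => Submodule.mem_top⟩
      continuousOn := fun _ => continuousOn_id
      map_diagonal := fun _ => rfl
      map_blockSum := fun _ _ => rfl }
    (fun _ _ _ => rfl) (fun _ _ _ => rfl)

end Relative

/-! ## Normalising the scalar part -/

section Normalise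

variable {B : Type*} [Ring B] [StarRing B] [Algebra ℂ B]

lemma map_mem_oddSAU {C : Type*} [Ring C] [StarRing C] [Algebra ℂ C] {γ : Grading B}
    {δ : Grading C} (φ : B →⋆ₐ[ℂ] C) (hγ : ∀ b, φ (γ.aut b) = δ.aut (φ b)) {n : ℕ}
    {x : Matrix (Fin n) (Fin n) B} (hx : x ∈ oddSAU (γ.matrix (Fin n))) :
    x.map φ ∈ oddSAU (δ.matrix (Fin n)) := by
  obtain ⟨h1, h2, h3⟩ := hx
  refine ⟨?_, ?_, ?_⟩
  · ext i j
    change star (φ (x j i)) = φ (x i j)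
    rw [← map_star]
    exact congrArg φ (congrFun (congrFun h1 i) j)
  · have := congrArg (φ : B →+* C).mapMatrix h2
    rw [map_mul, map_one] at this
    exact this
  · ext i j
    change δ.aut (φ (x i j)) = -(φ (x i j))
    rw [← hγ, ← map_neg]
    exact congrArg φ (congrFun (congrFun h3 i) j)

lemma matrixHom_ev {C : Type*} [Ring C] [StarRing C] [Algebra ℂ C] {γ : Grading B}
    {δ : Grading C} (φ : B →⋆ₐ[ℂ] C) (hγ : ∀ b, φ (γ.aut b) = δ.aut (φ b))
    (x : Matrix (Fin 2) (Fin 2) B) : matrixHom φ (γ.ev.aut x) = δ.ev.aut (matrixHom φ x) := by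
  have hz : matrixHom φ (sigmaZ B) = sigmaZ C := by
    ext i j; fin_cases i <;> fin_cases j <;> simp [matrixHom, sigmaZ]
  change matrixHom φ (sigmaZ B * x.map γ.aut * sigmaZ B) = sigmaZ C * _ * sigmaZ C
  rw [map_mul, map_mul, hz]
  congr 2
  ext i j
  exact hγ _

lemma matrixHom_sigmaX {C : Type*} [Ring C] [StarRing C] [Algebra ℂ C] (φ : B →⋆ₐ[ℂ] C) :
    matrixHom φ (sigmaX B) = sigmaX C := by
  ext i j; fin_cases i <;> fin_cases j <;> simp [matrixHom, sigmaX]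

/-- The unitary `diag(1, w)` of `M₂(M_n(B))` for a scalar matrix `w`, as a matrix of
`M_n(M₂(B))`. -/
def scalarTwist (B : Type*) [Ring B] [Algebra ℂ B] {n : ℕ} (w : Matrix (Fin n) (Fin n) ℂ) :
    Matrix (Fin n) (Fin n) (Matrix (Fin 2) (Fin 2) B) :=
  diagBlocks 1 ((algebraMap ℂ B).mapMatrix w)

variable {n : ℕ}

omit [StarRing B] in
lemma scalarTwist_mul (w w' : Matrix (Fin n) (Fin n) ℂ) :
    scalarTwist B w * scalarTwist B w' = scalarTwist B (w * w') := by
  rw [scalarTwist, scalarTwist, diagBlocks_mul, one_mul, ← map_mul, scalarTwist]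

omit [StarRing B] in
lemma scalarTwist_one : scalarTwist B (1 : Matrix (Fin n) (Fin n) ℂ) = 1 := by
  rw [scalarTwist, map_one, diagBlocks_one]

omit [StarRing B] in
lemma scalarTwist_blockSum {m : ℕ} (w : Matrix (Fin n) (Fin n) ℂ) (w' : Matrix (Fin m) (Fin m) ℂ) :
    scalarTwist B (blockSum w w') = blockSum (scalarTwist B w) (scalarTwist B w') := by
  rw [scalarTwist, scalarTwist, scalarTwist, ← diagBlocks_blockSum, blockSum_one]
  congr 1
  exact blockSum_map w w' (algebraMap ℂ B) (map_zero _)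

lemma map_scalarTwist {C : Type*} [Ring C] [StarRing C] [Algebra ℂ C] (φ : B →⋆ₐ[ℂ] C)
    (w : Matrix (Fin n) (Fin n) ℂ) :
    (scalarTwist B w).map (matrixHom φ) = scalarTwist C w := by
  ext i j k l
  change φ (scalarTwist B w i j k l) = _
  by_cases h : i = j
  · subst h
    fin_cases k <;> fin_cases l <;> simp [scalarTwist, diagBlocks, AlgHomClass.commutes]
  · fin_cases k <;> fin_cases l <;>
      simp [scalarTwist, diagBlocks, Matrix.one_apply_ne h, AlgHomClass.commutes]

/-- The matrix diag(1, w) commutes with σ_z, and γ fixes scalars. Evenness is what lets conjugation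
with it preserve oddness. -/
lemma scalarTwist_even (γ : Grading B) (w : Matrix (Fin n) (Fin n) ℂ) :
    (γ.ev.matrix (Fin n)).aut (scalarTwist B w) = scalarTwist B w := by
  have h0 : γ.aut 0 = 0 := map_zero γ.aut
  have h1 : γ.aut 1 = 1 := map_one γ.aut
  have hs : ∀ z, γ.aut (algebraMap ℂ B z) = algebraMap ℂ B z := fun z => by
    rw [Algebra.algebraMap_eq_smul_one, map_smul, h1]
  ext i j : 1
  change sigmaZ B * (scalarTwist B w i j).map γ.aut * sigmaZ B = _
  ext k l
  by_cases h : i = j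
  · subst h
    fin_cases k <;> fin_cases l <;>
      simp [sigmaZ, scalarTwist, diagBlocks, Matrix.mul_apply, Fin.sum_univ_two, Matrix.vecMul,
        dotProduct, h0, h1, hs]
  · fin_cases k <;> fin_cases l <;>
      simp [sigmaZ, scalarTwist, diagBlocks, Matrix.mul_apply, Fin.sum_univ_two, Matrix.vecMul,
        dotProduct, h0, hs, Matrix.one_apply_ne h]

variable [StarModule ℂ B]

lemma star_scalarTwist (w : Matrix (Fin n) (Fin n) ℂ) :
    star (scalarTwist B w) = scalarTwist B (star w) := by
  rw [scalarTwist, star_diagBlocks, star_one, star_mapMatrix, scalarTwist]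

/-- Conjugation with `diag(1, w)` preserves odd self-adjoint unitaries. -/
lemma scalarTwist_conj_mem (γ : Grading B) {w : Matrix (Fin n) (Fin n) ℂ}
    (hw : w ∈ unitary (Matrix (Fin n) (Fin n) ℂ))
    {x : Matrix (Fin n) (Fin n) (Matrix (Fin 2) (Fin 2) B)}
    (hx : x ∈ oddSAU (γ.ev.matrix (Fin n))) :
    scalarTwist B (star w) * x * scalarTwist B w ∈ oddSAU (γ.ev.matrix (Fin n)) := by
  obtain ⟨h1, h2, h3⟩ := hx
  obtain ⟨w1, w2⟩ := Unitary.mem_iff.mp hw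
  refine ⟨?_, ?_, ?_⟩
  · rw [star_mul, star_mul, star_scalarTwist, star_scalarTwist, star_star, h1, mul_assoc]
  · calc scalarTwist B (star w) * x * scalarTwist B w *
          (scalarTwist B (star w) * x * scalarTwist B w)
        = scalarTwist B (star w) * x * (scalarTwist B w * scalarTwist B (star w)) * x *
          scalarTwist B w := by simp only [mul_assoc]
      _ = scalarTwist B (star w) * (x * x) * scalarTwist B w := by
          rw [scalarTwist_mul, w2, scalarTwist_one, mul_one]; simp only [mul_assoc]
      _ = 1 := by rw [h2, mul_one, scalarTwist_mul, w1, scalarTwist_one]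
  · rw [map_mul, map_mul, scalarTwist_even, scalarTwist_even, h3, mul_neg, neg_mul]

variable (ε : B →⋆ₐ[ℂ] ℂ)

/-- The unitary scalar part of an odd self-adjoint unitary. -/
def scalarPart (x : Matrix (Fin n) (Fin n) (Matrix (Fin 2) (Fin 2) B)) : Matrix (Fin n) (Fin n) ℂ :=
  lowerLeft (x.map (matrixHom ε))

omit [StarModule ℂ B] in
lemma scalarPart_sigmaXs : scalarPart ε (sigmaXs B n) = 1 := by
  have : (sigmaXs B n).map (matrixHom ε) = sigmaXs ℂ n := by
    rw [sigmaXs, Matrix.diagonal_map (map_zero _), matrixHom_sigmaX]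
    rfl
  rw [scalarPart, this, lowerLeft_sigmaXs]

/-- Conjugation with a scalar unitary that turns the scalar part of an odd self-adjoint unitary
into `σ_x ⊕ ⋯ ⊕ σ_x`. -/
def normalise (x : Matrix (Fin n) (Fin n) (Matrix (Fin 2) (Fin 2) B)) :
    Matrix (Fin n) (Fin n) (Matrix (Fin 2) (Fin 2) B) :=
  scalarTwist B (star (scalarPart ε x)) * x * scalarTwist B (scalarPart ε x)

omit [StarModule ℂ B] in
lemma normalise_of_scalarPart {x : Matrix (Fin n) (Fin n) (Matrix (Fin 2) (Fin 2) B)}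
    (h : scalarPart ε x = 1) : normalise ε x = x := by
  rw [normalise, h, star_one, scalarTwist_one, one_mul, mul_one]

omit [StarModule ℂ B] in
lemma normalise_blockSum {m : ℕ} (x : Matrix (Fin n) (Fin n) (Matrix (Fin 2) (Fin 2) B))
    (y : Matrix (Fin m) (Fin m) (Matrix (Fin 2) (Fin 2) B)) :
    normalise ε (blockSum x y) = blockSum (normalise ε x) (normalise ε y) := by
  have : scalarPart ε (blockSum x y) = blockSum (scalarPart ε x) (scalarPart ε y) := by
    rw [scalarPart, blockSum_map _ _ _ (map_zero _), lowerLeft_blockSum]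
    rfl
  rw [normalise, this, star_blockSum, scalarTwist_blockSum, scalarTwist_blockSum, blockSum_mul,
    blockSum_mul]
  rfl

/-- The `2 × 2` matrices whose entries are in the kernel of `ε`. -/
def augKer : Submodule ℂ (Matrix (Fin 2) (Fin 2) B) :=
  LinearMap.ker (matrixHom ε).toAlgHom.toLinearMap

omit [StarModule ℂ B] in
lemma mem_augKer {x : Matrix (Fin 2) (Fin 2) B} : x ∈ augKer ε ↔ ∀ i j, ε (x i j) = 0 :=
  ⟨fun h i j => congrFun (congrFun h i) j, fun h => Matrix.ext h⟩

-- Links the two descriptions of a normalised matrix: membership in the relative family for `augKer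
-- ε`, and having scalar part σ_x ⊕ ⋯ ⊕ σ_x.
omit [StarModule ℂ B] in
lemma sub_sigmaXs_mem_augKer {x : Matrix (Fin n) (Fin n) (Matrix (Fin 2) (Fin 2) B)} :
    (∀ i j, x i j - Matrix.diagonal (fun _ => sigmaX B) i j ∈ augKer ε) ↔
      x.map (matrixHom ε) = sigmaXs ℂ n := by
  have h : ∀ i j, matrixHom ε ((Matrix.diagonal fun _ : Fin n => sigmaX B) i j) =
      sigmaXs ℂ n i j := fun i j => by
    rw [sigmaXs, ← matrixHom_sigmaX ε]
    by_cases h : i = j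
    · subst h; simp
    · simp [h]
  constructor
  · intro hx
    ext i j : 1
    have := hx i j
    change matrixHom ε (x i j - _) = 0 at this
    rw [map_sub, sub_eq_zero, h] at this
    exact this
  · intro hx i j
    change matrixHom ε (x i j - _) = 0
    rw [map_sub, sub_eq_zero, h]
    exact congrFun (congrFun hx i) j

variable {γ : Grading B} (hε : ∀ b, ε (γ.aut b) = ε b)

include hε

omit [StarModule ℂ B] in
lemma scalarPart_mem {x : Matrix (Fin n) (Fin n) (Matrix (Fin 2) (Fin 2) B)}
    (hx : x ∈ oddSAU (γ.ev.matrix (Fin n))) :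
    scalarPart ε x ∈ unitary (Matrix (Fin n) (Fin n) ℂ) :=
  lowerLeft_mem_unitary (map_mem_oddSAU (matrixHom ε) (matrixHom_ev ε hε) hx)

variable [TopologicalSpace B] [IsTopologicalRing B] [ContinuousSMul ℂ B]

/-- The scalar part of x is diag(u*, u)σ_x, and diag(1, u*) · diag(u*, u)σ_x · diag(1, u) =
diag(u*u, u*u)σ_x = σ_x ⊕ ⋯ ⊕ σ_x. -/
lemma normalise_mem {x : Matrix (Fin n) (Fin n) (Matrix (Fin 2) (Fin 2) B)}
    (hx : x ∈ oddSAU (γ.ev.matrix (Fin n))) :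
    normalise ε x ∈ (relOddFamily γ.ev (sigmaX B) (sigmaX_joined γ).source_mem
      (augKer ε)).carrier n := by
  have hu := scalarPart_mem ε hε hx
  refine ⟨scalarTwist_conj_mem γ hu hx, (sub_sigmaXs_mem_augKer ε).mpr ?_⟩
  have hx' := map_mem_oddSAU (δ := cliffordGrading ℂ) (matrixHom ε) (matrixHom_ev ε hε) hx
  have e : (normalise ε x).map (matrixHom ε) = scalarTwist ℂ (star (scalarPart ε x)) *
      x.map (matrixHom ε) * scalarTwist ℂ (scalarPart ε x) := by
    rw [← map_scalarTwist ε, ← map_scalarTwist ε]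
    let f : Matrix (Fin n) (Fin n) (Matrix (Fin 2) (Fin 2) B) →+*
        Matrix (Fin n) (Fin n) (Matrix (Fin 2) (Fin 2) ℂ) :=
      (matrixHom ε : Matrix (Fin 2) (Fin 2) B →+* Matrix (Fin 2) (Fin 2) ℂ).mapMatrix
    exact (map_mul f _ _).trans (congrArg (· * _) (map_mul f _ _))
  rw [e, eq_diagBlocks_of_mem_oddSAU hx']
  change scalarTwist ℂ (star (scalarPart ε x)) * (diagBlocks (star (scalarPart ε x))
    (scalarPart ε x) * _) * _ = _
  obtain ⟨u1, u2⟩ := Unitary.mem_iff.mp hu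
  set u := scalarPart ε x
  have hm : ∀ w : Matrix (Fin n) (Fin n) ℂ, (algebraMap ℂ ℂ).mapMatrix w = w := fun _ => rfl
  rw [scalarTwist, scalarTwist, hm, hm, ← mul_assoc, mul_assoc, sigmaXs_mul_diagBlocks,
    ← mul_assoc, diagBlocks_mul, diagBlocks_mul, one_mul, mul_one, u1, diagBlocks_one,
    one_mul]

omit hε in
lemma continuous_scalarTwist :
    Continuous (scalarTwist B : Matrix (Fin n) (Fin n) ℂ → _) :=
  continuous_diagBlocks.comp
    (continuous_const.prodMk (continuous_id.matrix_map (continuous_algebraMap ℂ B)))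

-- The normalising unitary is read off from x itself, without choices, so whole homotopies can be
-- normalised.
omit hε in
lemma continuous_normalise (hc : Continuous ε) :
    Continuous (normalise ε : Matrix (Fin n) (Fin n) (Matrix (Fin 2) (Fin 2) B) → _) := by
  have h : Continuous (scalarPart ε : Matrix (Fin n) (Fin n) (Matrix (Fin 2) (Fin 2) B) → _) :=
    continuous_lowerLeft.comp (continuous_id.matrix_map (continuous_id.matrix_map hc))
  exact ((continuous_scalarTwist.comp h.star).mul continuous_id).mul (continuous_scalarTwist.comp h)

/-- A path in U(M_n(ℂ)) from 1 to the scalar part of x gives a path of conjugates of x. -/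
lemma joinedIn_normalise {x : Matrix (Fin n) (Fin n) (Matrix (Fin 2) (Fin 2) B)}
    (hx : x ∈ oddSAU (γ.ev.matrix (Fin n))) :
    JoinedIn (oddSAU (γ.ev.matrix (Fin n))) x (normalise ε x) := by
  have hf : Continuous fun w : Matrix (Fin n) (Fin n) ℂ =>
      scalarTwist B (star w) * x * scalarTwist B w :=
    have h : Continuous fun w : Matrix (Fin n) (Fin n) ℂ => scalarTwist B (star w) :=
      continuous_scalarTwist.comp continuous_star
    (h.mul continuous_const).mul continuous_scalarTwist
  have := ((joinedIn_unitary_complex (scalarPart_mem ε hε hx)).map hf).mono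
    (V := oddSAU (γ.ev.matrix (Fin n))) (by
      rintro _ ⟨w, hw, rfl⟩
      exact scalarTwist_conj_mem γ hw hx)
  simp only [star_one, scalarTwist_one, one_mul, mul_one] at this
  exact this

/-- The map of matrix families given by `normalise`. -/
def normaliseHom (hc : Continuous ε) :
    MatrixFamily.Hom (oddFamily γ.ev (sigmaX B) (sigmaX_joined γ).source_mem)
      (relOddFamily γ.ev (sigmaX B) (sigmaX_joined γ).source_mem (augKer ε)) where
  toFun _ := normalise ε
  mapsTo _ _ hx := normalise_mem ε hε hx
  continuousOn _ := (continuous_normalise ε hc).continuousOn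
  map_diagonal _ := normalise_of_scalarPart ε (scalarPart_sigmaXs ε)
  map_blockSum _ _ := normalise_blockSum ε _ _

/-- Every class in `DK` has a representative whose scalar part is `σ_x ⊕ ⋯ ⊕ σ_x`, and homotopies
can be chosen with this scalar part. -/
def relAugEquiv (hc : Continuous ε) :
    (relOddFamily γ.ev (sigmaX B) (sigmaX_joined γ).source_mem (augKer ε)).V ≃+ DK γ where
  toFun := (relInclusion γ.ev (sigmaX B) (sigmaX_joined γ).source_mem (augKer ε)).toAddMonoidHom
  invFun := (normaliseHom ε hε hc).toAddMonoidHom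
  -- On normalised matrices `normalise` is the identity on the nose; in the other composite it is so
  -- only up to homotopy.
  left_inv := by
    rintro ⟨n, x, hx⟩
    change MatrixFamily.cls _ _ ((normaliseHom ε hε hc).mapsTo n hx.1) = MatrixFamily.cls _ x hx
    have : normalise ε x = x := normalise_of_scalarPart ε (by
      rw [scalarPart, (sub_sigmaXs_mem_augKer ε).mp hx.2, lowerLeft_sigmaXs])
    simp only [normaliseHom, this]
  right_inv := by
    rintro ⟨n, x, hx⟩
    exact (MatrixFamily.cls_eq_of_joined _ (joinedIn_normalise ε hε hx)).symm
  map_add' := map_add (relInclusion γ.ev (sigmaX B) (sigmaX_joined γ).source_mem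
    (augKer ε)).toAddMonoidHom

end Normalise

/-! ## Conjugation with a multiplier -/

section Twist

variable {B D : Type*} [Ring B] [StarRing B] [Algebra ℂ B] [Ring D] [StarRing D] [Algebra ℂ D]
  (j : B →⋆ₐ[ℂ] D) (W : Matrix (Fin 2) (Fin 2) D)

open Classical in
/-- The preimage under `j` of `W * j(m) * W`, if there is one. -/
def twist (m : Matrix (Fin 2) (Fin 2) B) : Matrix (Fin 2) (Fin 2) B :=
  if h : ∃ m', matrixHom j m' = W * matrixHom j m * W then h.choose else 0

variable {j W}

lemma matrixHom_twist {m m' : Matrix (Fin 2) (Fin 2) B}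
    (h : matrixHom j m' = W * matrixHom j m * W) :
    matrixHom j (twist j W m) = W * matrixHom j m * W := by
  have hex : ∃ m', matrixHom j m' = W * matrixHom j m * W := ⟨m', h⟩
  rw [twist, dif_pos hex]
  exact hex.choose_spec

variable (hinj : Function.Injective j)

include hinj

lemma matrixHom_injective : Function.Injective (matrixHom j) := fun _ _ h => by
  ext k l
  exact hinj (congrFun (congrFun h k) l)

/-- Injectivity of j makes the preimage unique, so the choice made in `twist` is harmless. -/
lemma twist_eq {m m' : Matrix (Fin 2) (Fin 2) B} (h : matrixHom j m' = W * matrixHom j m * W) :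
    twist j W m = m' :=
  matrixHom_injective hinj ((matrixHom_twist h).trans h.symm)

variable (hW : star W = W) (hWW : W * W = 1) (hWX : W * sigmaX D = sigmaX D * W)
  {I : Submodule ℂ (Matrix (Fin 2) (Fin 2) B)}
  (hI : ∀ m ∈ I, ∃ m' ∈ I, matrixHom j m' = W * matrixHom j m * W)

lemma twist_zero : twist j W 0 = 0 := twist_eq hinj (by simp)

include hWW hWX in
lemma twist_sigmaX : twist j W (sigmaX B) = sigmaX B :=
  twist_eq hinj (by rw [matrixHom_sigmaX, hWX, mul_assoc, hWW, mul_one])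

include hWW hWX in
lemma twist_diagonal (n : ℕ) :
    (Matrix.diagonal fun _ : Fin n => sigmaX B).map (twist j W) =
      Matrix.diagonal fun _ => sigmaX B := by
  rw [Matrix.diagonal_map (twist_zero hinj)]
  congr 1
  funext i
  exact twist_sigmaX hinj hWW hWX

variable {n : ℕ} {x : Matrix (Fin n) (Fin n) (Matrix (Fin 2) (Fin 2) B)}

-- Each entry is an element of I plus an entry of σ_x ⊕ ⋯ ⊕ σ_x. Ad_W maps I into itself and fixes
-- σ_x, so the default value of `twist` never occurs on the relative family.
include hWW hWX hI in
lemma exists_twist (hx : ∀ k l, x k l - Matrix.diagonal (fun _ => sigmaX B) k l ∈ I)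
    (k l : Fin n) :
    matrixHom j (twist j W (x k l)) = W * matrixHom j (x k l) * W ∧
      twist j W (x k l) - Matrix.diagonal (fun _ => sigmaX B) k l ∈ I := by
  obtain ⟨m', hm', h⟩ := hI _ (hx k l)
  set d : Matrix (Fin 2) (Fin 2) B := Matrix.diagonal (fun _ : Fin n => sigmaX B) k l with hd
  have h1 : W * matrixHom j d * W = matrixHom j d := by
    rw [hd, Matrix.diagonal_apply]
    split_ifs
    · rw [matrixHom_sigmaX, hWX, mul_assoc, hWW, mul_one]
    · simp
  have h2 : matrixHom j (m' + d) = W * matrixHom j (x k l) * W := by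
    rw [map_add, h, map_sub, mul_sub, sub_mul, h1, sub_add_cancel]
  refine ⟨matrixHom_twist h2, ?_⟩
  rw [twist_eq hinj h2, add_sub_cancel_right]
  exact hm'

omit hinj in
lemma map_twist (h : ∀ k l, matrixHom j (twist j W (x k l)) = W * matrixHom j (x k l) * W) :
    (x.map (twist j W)).map (matrixHom j) =
      Matrix.diagonal (fun _ => W) * x.map (matrixHom j) * Matrix.diagonal (fun _ => W) := by
  ext k l : 1
  rw [Matrix.mul_diagonal, Matrix.diagonal_mul]
  exact h k l

lemma map_matrixHom_injective :
    Function.Injective fun y : Matrix (Fin n) (Fin n) (Matrix (Fin 2) (Fin 2) B) =>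
      y.map (matrixHom j) := fun _ _ h => by
  ext k l : 1
  exact matrixHom_injective hinj (congrFun (congrFun h k) l)

variable {γ δ : Grading B} {G H : Matrix (Fin 2) (Fin 2) D}
  (hG : ∀ m, matrixHom j (γ.ev.aut m) = G * matrixHom j m * G)
  (hH : ∀ m, matrixHom j (δ.ev.aut m) = H * matrixHom j m * H) (hGH : W * G = H * W)

-- After applying the injective j, `twist` is Ad_W with W a self-adjoint unitary, which preserves
-- self-adjoint unitaries. As W intertwines G and H, an element that is odd for Ad_G becomes odd for
-- Ad_H.
include hW hWW hG hH hGH in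
lemma twist_mem_oddSAU
    (h : ∀ k l, matrixHom j (twist j W (x k l)) = W * matrixHom j (x k l) * W)
    (hx : x ∈ oddSAU (γ.ev.matrix (Fin n))) :
    x.map (twist j W) ∈ oddSAU (δ.ev.matrix (Fin n)) := by
  have hGH' : G * W = W * H := by
    calc G * W = W * W * (G * W) := by rw [hWW, one_mul]
      _ = W * (W * G) * W := by simp only [mul_assoc]
      _ = W * H := by rw [hGH, mul_assoc, mul_assoc, hWW, mul_one]
  let f : Matrix (Fin n) (Fin n) (Matrix (Fin 2) (Fin 2) B) →+*
      Matrix (Fin n) (Fin n) (Matrix (Fin 2) (Fin 2) D) :=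
    (matrixHom j : Matrix (Fin 2) (Fin 2) B →+* Matrix (Fin 2) (Fin 2) D).mapMatrix
  have hf : ∀ y, f y = y.map (matrixHom j) := fun _ => rfl
  have hfinj : Function.Injective f := map_matrixHom_injective hinj
  have hWn : Matrix.diagonal (fun _ : Fin n => W) * Matrix.diagonal (fun _ => W) = 1 := by
    simp [hWW]
  have hm := map_twist h
  obtain ⟨h1, h2, h3⟩ := hx
  refine ⟨?_, ?_, ?_⟩
  · ext k l : 1
    refine matrixHom_injective hinj ?_
    change matrixHom j (star (twist j W (x l k))) = _
    have e : star (x l k) = x k l := congrFun (congrFun h1 k) l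
    rw [map_star, h, Matrix.map_apply, h, star_mul, star_mul, hW, ← map_star, e, mul_assoc]
  · refine hfinj ?_
    rw [map_mul, hf, hm]
    generalize Matrix.diagonal (fun _ : Fin n => W) = V at hWn
    calc V * x.map (matrixHom j) * V * (V * x.map (matrixHom j) * V)
        = V * f x * (V * V) * f x * V := by simp only [mul_assoc, hf]
      _ = V * (f x * f x) * V := by rw [hWn, mul_one]; simp only [mul_assoc]
      _ = f 1 := by rw [← map_mul, h2, map_one, mul_one, hWn]
  · ext k l : 1
    refine matrixHom_injective hinj ?_
    change matrixHom j (δ.ev.aut (twist j W (x k l))) = matrixHom j (-twist j W (x k l))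
    have e : γ.ev.aut (x k l) = -x k l := congrFun (congrFun h3 k) l
    rw [hH, map_neg, h]
    calc H * (W * matrixHom j (x k l) * W) * H
        = (H * W) * matrixHom j (x k l) * (W * H) := by simp only [mul_assoc]
      _ = W * (G * matrixHom j (x k l) * G) * W := by
          rw [← hGH, ← hGH']; simp only [mul_assoc]
      _ = -(W * matrixHom j (x k l) * W) := by
          rw [← hG, e, map_neg, mul_neg, neg_mul]

include hWW in
lemma twist_twist {m : Matrix (Fin 2) (Fin 2) B}
    (h : matrixHom j (twist j W m) = W * matrixHom j m * W) :
    twist j W (twist j W m) = m := by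
  refine twist_eq hinj ?_
  calc matrixHom j m = W * W * matrixHom j m * (W * W) := by rw [hWW, one_mul, mul_one]
    _ = W * matrixHom j (twist j W m) * W := by rw [h]; simp only [mul_assoc]

variable [StarModule ℂ B] [TopologicalSpace B] [TopologicalSpace D] [IsTopologicalRing B]
  [ContinuousSMul ℂ B] [IsTopologicalRing D] (hj : Topology.IsInducing j)

/-- Conjugation with `W`, as a map of matrix families. -/
def twistHom :
    MatrixFamily.Hom (relOddFamily γ.ev (sigmaX B) (sigmaX_joined γ).source_mem I)
      (relOddFamily δ.ev (sigmaX B) (sigmaX_joined δ).source_mem I) where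
  toFun _ x := x.map (twist j W)
  mapsTo _ x hx := ⟨twist_mem_oddSAU hinj hW hWW hG hH hGH
    (fun k l => (exists_twist hinj hWW hWX hI hx.2 k l).1) hx.1,
    fun k l => (exists_twist hinj hWW hWX hI hx.2 k l).2⟩
  continuousOn n := by
    -- `twist` is defined by choice, so continuity is checked after j, where it is given by the
    -- formula W · W.
    refine continuousOn_pi.mpr fun k => continuousOn_pi.mpr fun l => continuousOn_pi.mpr fun a =>
      continuousOn_pi.mpr fun b => hj.continuousOn_iff.mpr ?_
    have hc : Continuous fun x : Matrix (Fin n) (Fin n) (Matrix (Fin 2) (Fin 2) B) =>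
        (W * matrixHom j (x k l) * W) a b := by
      have h1 : Continuous fun x : Matrix (Fin n) (Fin n) (Matrix (Fin 2) (Fin 2) B) =>
          matrixHom j (x k l) :=
        (continuous_id.matrix_elem k l).matrix_map hj.continuous
      exact ((continuous_const.mul h1).mul continuous_const).matrix_elem a b
    refine hc.continuousOn.congr fun x hx => ?_
    exact congrFun (congrFun (exists_twist hinj hWW hWX hI hx.2 k l).1 a) b
  map_diagonal n := twist_diagonal hinj hWW hWX n
  map_blockSum {_ _ x y} _ _ := blockSum_map x y _ (twist_zero hinj)

/-- Conjugation with `W`, as an isomorphism of groups of stable homotopy classes. -/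
def twistEquiv :
    (relOddFamily γ.ev (sigmaX B) (sigmaX_joined γ).source_mem I).V ≃+
      (relOddFamily δ.ev (sigmaX B) (sigmaX_joined δ).source_mem I).V :=
  have hGH' : W * H = G * W := by
    calc W * H = W * (H * W) * W := by rw [mul_assoc, mul_assoc, hWW, mul_one]
      _ = W * W * (G * W) := by rw [← hGH]; simp only [mul_assoc]
      _ = G * W := by rw [hWW, one_mul]
  MatrixFamily.addEquivOfHoms (twistHom hinj hW hWW hWX hI hG hH hGH hj)
    (twistHom hinj hW hWW hWX hI hH hG hGH' hj)
    (fun _ _ hx => Matrix.ext fun k l =>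
      twist_twist hinj hWW (exists_twist hinj hWW hWX hI hx.2 k l).1)
    (fun _ _ hx => Matrix.ext fun k l =>
      twist_twist hinj hWW (exists_twist hinj hWW hWX hI hx.2 k l).1)

end Twist

/-! ### The unitary that conjugates Γ ⊗ σ_z into 1 ⊗ σ_z -/

section Inner

variable {B D : Type*} [Ring B] [StarRing B] [Algebra ℂ B] [Ring D] [StarRing D] [Algebra ℂ D]

/-- For a self-adjoint unitary `Γ = p - q` with projections `p + q = 1`, the self-adjoint unitary
`p ⊗ 1 + q ⊗ σ_x`, which conjugates `Γ ⊗ σ_z` into `1 ⊗ σ_z`. -/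
def intertwiner (Γ : D) : Matrix (Fin 2) (Fin 2) D :=
  (2⁻¹ : ℂ) • !![1 + Γ, 1 - Γ; 1 - Γ, 1 + Γ]

lemma star_intertwiner [StarModule ℂ D] {Γ : D} (h : star Γ = Γ) :
    star (intertwiner Γ) = intertwiner Γ := by
  rw [intertwiner, star_smul]
  congr 1
  · simp
  · ext i j; fin_cases i <;> fin_cases j <;> simp [Matrix.star_apply, h]

lemma intertwiner_mul_self {Γ : D} (h : Γ * Γ = 1) : intertwiner Γ * intertwiner Γ = 1 := by
  have h1 : (!![1 + Γ, 1 - Γ; 1 - Γ, 1 + Γ] : Matrix (Fin 2) (Fin 2) D) *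
      !![1 + Γ, 1 - Γ; 1 - Γ, 1 + Γ] = (4 : ℂ) • 1 := by
    have h4 : ∀ d : D, (4 : ℂ) • d = d + d + d + d := fun d => by
      rw [show (4 : ℂ) = 1 + 1 + 1 + 1 by norm_num, add_smul, add_smul, add_smul, one_smul]
    ext i j
    fin_cases i <;> fin_cases j <;>
      simp [Matrix.mul_apply, Fin.sum_univ_two, mul_add, add_mul, mul_sub, sub_mul, h, h4] <;> abel
  rw [intertwiner, smul_mul_smul_comm, h1, smul_smul]
  norm_num

/-- Both 1 and σ_x commute with σ_x; this keeps the base point fixed under conjugation. -/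
lemma intertwiner_mul_sigmaX (Γ : D) :
    intertwiner Γ * sigmaX D = sigmaX D * intertwiner Γ := by
  rw [intertwiner, smul_mul_assoc, mul_smul_comm]
  congr 1
  ext i j; fin_cases i <;> fin_cases j <;> simp [sigmaX, Matrix.mul_apply, Fin.sum_univ_two]

/-- On p, where Γ = 1, both sides are σ_z. On q, where Γ = −1, they are −σ_xσ_z and σ_zσ_x, which
agree by anticommutation. -/
lemma intertwiner_mul {Γ : D} (h : Γ * Γ = 1) :
    intertwiner Γ * !![Γ, 0; 0, -Γ] = sigmaZ D * intertwiner Γ := by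
  rw [intertwiner, smul_mul_assoc, mul_smul_comm]
  congr 1
  ext i j; fin_cases i <;> fin_cases j <;>
    simp [sigmaZ, Matrix.mul_apply, Fin.sum_univ_two, add_mul, sub_mul, h] <;> abel

/-- The matrix diag(Γ, −Γ) is Γ ⊗ σ_z, the product of the unitaries implementing γ and Ad_{σ_z}. -/
lemma matrixHom_ev_of_inner {γ : Grading B} {j : B →⋆ₐ[ℂ] D} {Γ : D}
    (hγ : ∀ b, j (γ.aut b) = Γ * j b * Γ) (m : Matrix (Fin 2) (Fin 2) B) :
    matrixHom j (γ.ev.aut m) = !![Γ, 0; 0, -Γ] * matrixHom j m * !![Γ, 0; 0, -Γ] := by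
  have hz : matrixHom j (sigmaZ B) = sigmaZ D := by
    ext i j; fin_cases i <;> fin_cases j <;> simp [matrixHom, sigmaZ]
  change matrixHom j (sigmaZ B * m.map γ.aut * sigmaZ B) = _
  rw [map_mul, map_mul, hz]
  have he : ∀ a b, matrixHom j (m.map γ.aut) a b = Γ * j (m a b) * Γ := fun a b => hγ _
  have he' : ∀ a b, matrixHom j m a b = j (m a b) := fun a b => rfl
  ext a b
  fin_cases a <;> fin_cases b <;>
    simp [sigmaZ, Matrix.mul_apply, Fin.sum_univ_two, Matrix.vecMul, dotProduct, he, he']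

lemma matrixHom_ev_trivial (j : B →⋆ₐ[ℂ] D) (m : Matrix (Fin 2) (Fin 2) B) :
    matrixHom j ((Grading.trivial B).ev.aut m) = sigmaZ D * matrixHom j m * sigmaZ D := by
  have := matrixHom_ev (γ := Grading.trivial B) (δ := Grading.trivial D) j (fun _ => rfl) m
  exact this

/-- Two-sided multiples of matrices with entries in a subspace that is mapped onto an ideal. -/
lemma exists_matrixHom_eq {j : B →⋆ₐ[ℂ] D} {P : B → Prop}
    (hadd : ∀ a b, P a → P b → P (a + b))
    (hP : ∀ b, P b → ∀ d d' : D, ∃ b', P b' ∧ j b' = d * j b * d')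
    (W : Matrix (Fin 2) (Fin 2) D) {m : Matrix (Fin 2) (Fin 2) B} (hm : ∀ a b, P (m a b)) :
    ∃ m' : Matrix (Fin 2) (Fin 2) B, (∀ a b, P (m' a b)) ∧
      matrixHom j m' = W * matrixHom j m * W := by
  choose f hf hf' using fun a b k l => hP (m k l) (hm k l) (W a k) (W l b)
  -- Here `f a b k l` lifts the summand W_{ak} m_{kl} W_{lb} of the (a, b) entry of W m W.
  refine ⟨fun a b => f a b 0 0 + f a b 1 0 + (f a b 0 1 + f a b 1 1), fun a b =>
    hadd _ _ (hadd _ _ (hf _ _ _ _) (hf _ _ _ _)) (hadd _ _ (hf _ _ _ _) (hf _ _ _ _)), ?_⟩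
  ext a b
  change j (f a b 0 0 + f a b 1 0 + (f a b 0 1 + f a b 1 1)) = _
  have he : ∀ a b, matrixHom j m a b = j (m a b) := fun a b => rfl
  simp only [map_add, hf', Matrix.mul_apply, Fin.sum_univ_two, he, add_mul]

variable [StarModule ℂ B] [TopologicalSpace B] [TopologicalSpace D] [IsTopologicalRing B]
  [ContinuousSMul ℂ B] [StarModule ℂ D] [IsTopologicalRing D]

/-- A grading that is implemented by a self-adjoint unitary of a larger algebra may be replaced by
the trivial one, relative to a subspace that is mapped onto an ideal of that algebra. -/
def relEquivOfInner {γ : Grading B} {j : B →⋆ₐ[ℂ] D} (hinj : Function.Injective j)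
    (hj : Topology.IsInducing j) {Γ : D} (hΓ : star Γ = Γ) (hΓΓ : Γ * Γ = 1)
    (hγ : ∀ b, j (γ.aut b) = Γ * j b * Γ) {I : Submodule ℂ (Matrix (Fin 2) (Fin 2) B)}
    (hI : ∀ W : Matrix (Fin 2) (Fin 2) D, ∀ m ∈ I, ∃ m' ∈ I,
      matrixHom j m' = W * matrixHom j m * W) :
    (relOddFamily γ.ev (sigmaX B) (sigmaX_joined γ).source_mem I).V ≃+
      (relOddFamily (cliffordGrading B) (sigmaX B)
        (sigmaX_joined (Grading.trivial B)).source_mem I).V :=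
  twistEquiv hinj (star_intertwiner hΓ) (intertwiner_mul_self hΓΓ) (intertwiner_mul_sigmaX Γ)
    (hI _) (matrixHom_ev_of_inner hγ) (matrixHom_ev_trivial j) (intertwiner_mul hΓΓ) hj

end Inner

/-! ## The multiplier algebra -/

section Multiplier

variable {A : Type*} [NonUnitalCStarAlgebra A]

/-- Testing with c = (a − b)* and the C⋆-identity replace the missing unit. -/
lemma eq_of_forall_mul_eq {a b : A} (h : ∀ c, c * a = c * b) : a = b := by
  have := h (star (a - b))
  rw [← sub_eq_zero, ← mul_sub, CStarRing.star_mul_self_eq_zero_iff, sub_eq_zero] at this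
  exact this

lemma eq_of_forall_mul_eq' {a b : A} (h : ∀ c, a * c = b * c) : a = b := by
  have := h (star (a - b))
  rw [← sub_eq_zero, ← sub_mul, CStarRing.mul_star_self_eq_zero_iff, sub_eq_zero] at this
  exact this

lemma coe_multiplier_injective :
    Function.Injective (DoubleCentralizer.coe ℂ : A → DoubleCentralizer ℂ A) := fun _ _ h =>
  eq_of_forall_mul_eq' fun c => congrArg (fun d : DoubleCentralizer ℂ A => d.fst c) h

/-- A C⋆-algebra is a left ideal of its multiplier algebra. -/
lemma multiplier_mul_coe (d : DoubleCentralizer ℂ A) (a : A) :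
    d * DoubleCentralizer.coe ℂ a = DoubleCentralizer.coe ℂ (d.fst a) := by
  have h2 : ∀ x, d.snd x * a = x * d.fst a := fun x => d.central x a
  refine DoubleCentralizer.ext _ _ _ _ (Prod.ext ?_ ?_)
  · ext c
    change d.fst (a * c) = d.fst a * c
    -- After multiplication by x from the left, centrality turns the left multiplier on one side
    -- into the right multiplier on x, and associativity finishes.
    refine eq_of_forall_mul_eq fun x => ?_
    rw [← d.central, ← mul_assoc, ← mul_assoc, h2]
  · ext x
    exact h2 x

/-- A C⋆-algebra is a right ideal of its multiplier algebra. -/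
lemma coe_mul_multiplier (a : A) (d : DoubleCentralizer ℂ A) :
    DoubleCentralizer.coe ℂ a * d = DoubleCentralizer.coe ℂ (d.snd a) := by
  have h2 : ∀ x, d.snd a * x = a * d.fst x := fun x => d.central a x
  refine DoubleCentralizer.ext _ _ _ _ (Prod.ext ?_ ?_)
  · ext x
    exact (h2 x).symm
  · ext c
    change d.snd (c * a) = c * d.snd a
    refine eq_of_forall_mul_eq' fun x => ?_
    rw [d.central, mul_assoc, mul_assoc, h2]

lemma multiplier_mul_coe_mul (d d' : DoubleCentralizer ℂ A) (a : A) :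
    d * DoubleCentralizer.coe ℂ a * d' = DoubleCentralizer.coe ℂ (d'.snd (d.fst a)) := by
  rw [multiplier_mul_coe, coe_mul_multiplier]

/-- The canonical map of a unital C⋆-algebra to its multiplier algebra. -/
def multiplierHom (A : Type*) [CStarAlgebra A] : A →⋆ₐ[ℂ] DoubleCentralizer ℂ A :=
  have h1 : DoubleCentralizer.coe ℂ (1 : A) = 1 := by
    refine DoubleCentralizer.ext _ _ _ _ (Prod.ext ?_ ?_)
    · ext c; exact one_mul c
    · ext c; exact mul_one c
  { (DoubleCentralizer.coeHom : A →⋆ₙₐ[ℂ] DoubleCentralizer ℂ A) with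
    map_one' := h1
    commutes' := fun r => by
      change DoubleCentralizer.coeHom (algebraMap ℂ A r) = _
      rw [Algebra.algebraMap_eq_smul_one, map_smul, Algebra.algebraMap_eq_smul_one]
      exact congrArg (r • ·) h1 }

/-- The canonical map of `A⁺` to `𝓜(A) × ℂ`. -/
def unitizationHom (A : Type*) [NonUnitalCStarAlgebra A] :
    Unitization ℂ A →⋆ₐ[ℂ] DoubleCentralizer ℂ A × ℂ :=
  (Unitization.starLift (DoubleCentralizer.coeHom : A →⋆ₙₐ[ℂ] DoubleCentralizer ℂ A)).prod
    (augmentation A)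

lemma unitizationHom_apply (x : Unitization ℂ A) :
    unitizationHom A x = (algebraMap ℂ _ x.fst + DoubleCentralizer.coe ℂ x.snd, x.fst) := by
  induction x using Unitization.ind with
  | inl_add_inr r a =>
    refine Prod.ext ?_ ?_
    · simp [unitizationHom, Unitization.starLift]
    · rfl

/-- The coordinate in ℂ is indispensable: for unital A, the map A⁺ → 𝓜(A) alone kills the difference
of the two units. -/
lemma unitizationHom_injective : Function.Injective (unitizationHom A) := fun x y h => by
  rw [unitizationHom_apply, unitizationHom_apply, Prod.mk.injEq] at h
  obtain ⟨h1, h2⟩ := h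
  rw [h2] at h1
  exact Unitization.ext h2 (coe_multiplier_injective (add_left_cancel h1))

/-- Scalars commute with Γ and Γ² = 1, so conjugation fixes the scalar part, as γ⁺ does. On the
coordinate in ℂ the grading is trivial and 1 implements it. -/
lemma unitizationHom_isInner {γ : Grading A} {Γ : DoubleCentralizer ℂ A} (hs : star Γ = Γ)
    (hΓ : Γ * Γ = 1)
    (h : ∀ a : A, DoubleCentralizer.coe ℂ (γ.aut a) = Γ * DoubleCentralizer.coe ℂ a * star Γ)
    (x : Unitization ℂ A) :
    unitizationHom A (γ.unitization.aut x) = (Γ, 1) * unitizationHom A x * (Γ, 1) := by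
  have e : γ.unitization.aut x = Unitization.inl x.fst + ((γ.aut x.snd : A) : Unitization ℂ A) := by
    change Unitization.starMap (γ.aut : A →⋆ₙₐ[ℂ] A) x = _
    induction x using Unitization.ind with
    | inl_add_inr r a => simp [Unitization.algebraMap_eq_inl]
  rw [e, unitizationHom_apply, unitizationHom_apply]
  refine Prod.ext ?_ (by simp)
  simp only [Unitization.fst_add, Unitization.fst_inl, Unitization.fst_inr, add_zero,
    Unitization.snd_add, Unitization.snd_inl, Unitization.snd_inr, zero_add, Prod.mk_mul_mk,
    mul_add, add_mul]
  rw [h, hs, ← Algebra.commutes, mul_assoc _ Γ Γ, hΓ, mul_one]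

end Multiplier

/-! ## The isomorphisms -/

/-- The isomorphism `DK(A, γ) ≅ K₁(A, id)` for an inner graded unital C⋆-algebra. -/
lemma nonempty_DK_equiv_K1 {A : Type*} [CStarAlgebra A] {γ : Grading A} (hγ : γ.IsInner) :
    Nonempty (DK γ ≃+ K1 A) := by
  obtain ⟨Γ, hs, hΓ, h⟩ := hγ
  have hinj : Function.Injective (multiplierHom A) := coe_multiplier_injective
  -- Injective star homomorphisms of C⋆-algebras are isometric.
  have hj : Topology.IsInducing (multiplierHom A) :=
    (NonUnitalStarAlgHom.isometry (multiplierHom A) hinj).isEmbedding.isInducing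
  have e := relEquivOfInner (γ := γ) (I := ⊤) hinj hj hs hΓ
    (fun b => by have := h b; rw [hs] at this; exact this)
    (fun W m _ => by
      obtain ⟨m', -, hm⟩ := exists_matrixHom_eq (j := multiplierHom A) (P := fun _ => True)
        (fun _ _ _ _ => trivial) (fun b _ d d' => ⟨d'.snd (d.fst b), trivial,
          (multiplier_mul_coe_mul d d' b).symm⟩) W (m := m) (fun _ _ => trivial)
      exact ⟨m', Submodule.mem_top, hm⟩)
  exact ⟨((relTopEquiv _ _ _).symm.trans e).trans (relTopEquiv _ _ _)⟩

/-- The isomorphism `DK(A⁺, γ⁺) ≅ K₁(A⁺, id)` for an inner graded C⋆-algebra. -/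
lemma nonempty_DK_unitization_equiv_K1 {A : Type*} [NonUnitalCStarAlgebra A] {γ : Grading A}
    (hγ : γ.IsInner) : Nonempty (DK γ.unitization ≃+ K1 (Unitization ℂ A)) := by
  obtain ⟨Γ, hs, hΓ, h⟩ := hγ
  have hj : Topology.IsInducing (unitizationHom A) :=
    (NonUnitalStarAlgHom.isometry (unitizationHom A) unitizationHom_injective).isEmbedding.isInducing
  have e := relEquivOfInner (γ := γ.unitization) (I := augKer (augmentation A)) (Γ := (Γ, 1))
    unitizationHom_injective hj (Prod.ext hs (star_one ℂ)) (Prod.ext hΓ (one_mul 1))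
    (unitizationHom_isInner hs hΓ h)
    (fun W m hm => by
      obtain ⟨m', hm', hm''⟩ := exists_matrixHom_eq (j := unitizationHom A)
        (P := fun x => augmentation A x = 0)
        (fun a b ha hb => by rw [map_add, ha, hb, add_zero]) (fun b hb d d' => by
          -- An element with zero scalar part lies in A, and A absorbs multipliers from both sides;
          -- the coordinate in ℂ stays 0.
          refine ⟨((d'.1.snd (d.1.fst b.snd) : A) : Unitization ℂ A), rfl, ?_⟩
          have hb' : b.fst = 0 := hb
          rw [unitizationHom_apply, unitizationHom_apply, hb', Unitization.fst_inr,
            Unitization.snd_inr, map_zero, zero_add, zero_add, ← multiplier_mul_coe_mul]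
          exact Prod.ext rfl (by simp)) W ((mem_augKer _).mp hm)
      exact ⟨m', (mem_augKer _).mpr hm', hm''⟩)
  exact ⟨((relAugEquiv (augmentation A) (augmentation_unitization γ)
    continuous_augmentation).symm.trans e).trans (relAugEquiv (γ := Grading.trivial _)
      (augmentation A) (fun _ => rfl) continuous_augmentation)⟩

/-- The kernel of a homomorphism to a trivial group is everything. -/
def kerEquivOfSubsingleton {G H : Type*} [AddCommGroup G] [AddCommGroup H] [Subsingleton H]
    (f : G →+ H) : f.ker ≃+ G where
  toFun x := x
  invFun x := ⟨x, Subsingleton.elim _ _⟩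
  left_inv _ := rfl
  right_inv _ := rfl
  map_add' _ _ := rfl

lemma K1_complex_subsingleton : Subsingleton (K1 ℂ) :=
  have := KU1_complex_subsingleton
  (K1.equivKU1 (B := ℂ)).toEquiv.subsingleton

end VanDaele

end

theorem mainTheorem6 :
    (∀ (A : Type*) [CStarAlgebra A] (γ : VanDaele.Grading A), γ.IsInner →
      Nonempty (VanDaele.DK γ ≃+ VanDaele.K1 A) ∧
      Nonempty (VanDaele.K1 A ≃+ VanDaele.KU1 A)) ∧
    (∀ (A : Type*) [NonUnitalCStarAlgebra A] (γ : VanDaele.Grading A), γ.IsInner →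
      Nonempty (VanDaele.DKNonunital γ ≃+ VanDaele.K1Nonunital A) ∧
      Nonempty (VanDaele.K1Nonunital A ≃+ VanDaele.KU1Nonunital A)) := by
  refine ⟨fun A _ γ hγ => ⟨VanDaele.nonempty_DK_equiv_K1 hγ, ⟨VanDaele.K1.equivKU1⟩⟩,
    fun A _ γ hγ => ?_⟩
  have h1 : Subsingleton (VanDaele.K1 ℂ) := VanDaele.K1_complex_subsingleton
  -- For the trivial grading the two groups are the same by definition.
  have h2 : Subsingleton (VanDaele.DK (VanDaele.Grading.trivial ℂ)) := h1
  have h3 : Subsingleton (VanDaele.KU1 ℂ) := VanDaele.KU1_complex_subsingleton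
  obtain ⟨e⟩ := VanDaele.nonempty_DK_unitization_equiv_K1 hγ
  have eK : VanDaele.K1Nonunital A ≃+ VanDaele.K1 (Unitization ℂ A) :=
    VanDaele.kerEquivOfSubsingleton _
  have eD : VanDaele.DKNonunital γ ≃+ VanDaele.DK γ.unitization :=
    VanDaele.kerEquivOfSubsingleton _
  have eU : VanDaele.KU1Nonunital A ≃+ VanDaele.KU1 (Unitization ℂ A) :=
    VanDaele.kerEquivOfSubsingleton _
  exact ⟨⟨(eD.trans e).trans eK.symm⟩, ⟨(eK.trans VanDaele.K1.equivKU1).trans eU.symm⟩⟩
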